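/- Setting. For each $n\ge 1$ let $\mathbf y=X\beta^0+\epsilon$, where $\beta^0=\beta^0_{(n)}\in\mathbb R^{p}$, $p=p_n$, is deterministic, $X$ is a deterministic or random $n\times p$ matrix independent of $\epsilon$, and $\epsilon\sim N(0,\sigma_0^2I_n)$ with fixed $\sigma_0>0$; all the random objects live on one probability space. A model is a subset $\gamma\subseteq\{1,\dots,p\}$ (equivalently its 0-1 state vector), $|\gamma|$ is its size, $X_\gamma$ is the submatrix of the columns of $X$ indexed by $\gamma$, and $P_\gamma=X_\gamma(X_\gamma^TX_\gamma)^{-1}X_\gamma^T$, $P_\emptyset=0$. The true model is $\gamma^0=\{j:\beta^0_j\ne0\}$; put $k_n=\|\beta^0\|_2^2$, $S_1=\{\gamma:\gamma^0\subsetneq\gamma\}$, $S_2=\{\gamma:\gamma^0\not\subseteq\gamma\}$. With $\lambda_-,\lambda_+$ the minimal and maximal eigenvalue, let $$\varphi_{\min}(n)=\min_{\gamma\in S_2}\lambda_-\Big(\tfrac1nX_{\gamma^0\setminus\gamma}^T(I_n-P_\gamma)X_{\gamma^0\setminus\gamma}\Big),\qquad \varphi_{\max}(n)=\max_{\gamma\in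 S_2}\lambda_+\Big(\tfrac1nX_{\gamma^0\setminus\gamma}^TX_{\gamma^0\setminus\gamma}\Big).$$ Let $p(\cdot)$ be a prior probability distribution on the $2^p$ models (for each $n$), let $\nu>0$ be fixed, and for $c=(c_1,\dots,c_p)$ with positive entries let $\Sigma_\gamma=\mathrm{diag}(c_j)_{j\in\gamma}$, $U_\gamma=\Sigma_\gamma^{-1}+X_\gamma^TX_\gamma$, $W_\gamma=\Sigma_\gamma^{1/2}U_\gamma\Sigma_\gamma^{1/2}$. The posterior distribution of $\gamma$ given $Z=(\mathbf y,X)$ is the probability distribution on the models with $$p(\gamma|Z)\propto(2\pi)^{-n/2}\det(W_\gamma)^{-1/2}\,p(\gamma)\left\{\frac{2}{1+\mathbf y^T(I_n-X_\gamma U_\gamma^{-1}X_\gamma^T)\mathbf y}\right\}^{(n+\nu)/2},$$ where for $\gamma=\emptyset$ the determinant is $1$ and the denominator is $1+\mathbf y^T\mathbf y$. Theorem. Suppose that: (i) $\gamma^0\neq\emptyset$ for every $n$; (ii) there is a constant $C_0>0$ such that $p(\gamma^0)>0$ and $\max_\gamma p(\gamma)/p(\gamma^0)\le C_0$ for every $n$;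 (iii) there are constants $C_1,C_2>0$ such that, with probability one, $\liminf_n\varphi_{\min}(n)\ge C_1$ and $\limsup_n\varphi_{\max}(n)\le C_2$; (iv) there are constants $C_3>0$ and $\delta\ge0$ such that for every $n$, with probability one, $$\lambda_-\Big(\tfrac1nX_{\gamma\setminus\gamma^0}^T(I_n-P_{\gamma^0})X_{\gamma\setminus\gamma^0}\Big)\ge C_3n^{-\delta}\quad\text{for all }\gamma\in S_1;$$ (v) $\min_{j\in\gamma^0}|\beta^0_j|\ge\psi_n$ for every $n$, where $\inf_n\psi_n>0$; (vi) $p\log n=o(n)$; (vii) there is a constant $\delta_0>3+\delta$ such that $k_n=O(n^{\delta_0})$, and $0<\underline\phi_n\le\bar\phi_n$ are sequences with $\bar\phi_n=O(n^{\delta_0})$ and $n^{\delta_0}=O(\underline\phi_n)$. Then $$\inf_{c_1,\dots,c_p\in[\underline\phi_n,\bar\phi_n]}p(\gamma^0|Z)\longrightarrow1\quad\text{in probability as }n\to\infty.$$ -/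

import Mathlib

open MeasureTheory ProbabilityTheory Filter Asymptotics Matrix
open scoped Topology NNReal

namespace BayesSel

noncomputable section

/-- The model (state vector) of a coefficient vector `β`: the set of `j` with `β j ≠ 0`. State
vectors `γ ∈ {0,1}^p` are identified with subsets of `Fin p`. -/
def stateOf {p : ℕ} (β : Fin p → ℝ) : Finset (Fin p) :=
  Finset.univ.filter fun j => β j ≠ 0

/-- Models that strictly contain the true model. -/
def S₁ {p : ℕ} (γ₀ : Finset (Fin p)) : Set (Finset (Fin p)) :=
  {γ | γ₀ ⊆ γ ∧ γ ≠ γ₀}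

/-- Models in which the true model is not nested. -/
def S₂ {p : ℕ} (γ₀ : Finset (Fin p)) : Set (Finset (Fin p)) :=
  {γ | ¬ γ₀ ⊆ γ}

/-- The submatrix `X_γ` of the columns of `X` indexed by `γ`. -/
def cols {n p : ℕ} (X : Matrix (Fin n) (Fin p) ℝ) (γ : Finset (Fin p)) : Matrix (Fin n) γ ℝ :=
  X.submatrix id (fun j : γ => (j : Fin p))

/-- The projection matrix `P_γ = X_γ (X_γᵀ X_γ)⁻¹ X_γᵀ` (which is `0` for the empty model). -/
def proj {n p : ℕ} (X : Matrix (Fin n) (Fin p) ℝ) (γ : Finset (Fin p)) :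
    Matrix (Fin n) (Fin n) ℝ :=
  cols X γ * ((cols X γ)ᵀ * cols X γ)⁻¹ * (cols X γ)ᵀ

/-- The minimal eigenvalue (used for symmetric matrices of positive size only). -/
def eigMin {m : Type*} [Fintype m] [DecidableEq m] (A : Matrix m m ℝ) : ℝ :=
  sInf (spectrum ℝ A)

/-- The maximal eigenvalue (used for symmetric matrices of positive size only). -/
def eigMax {m : Type*} [Fintype m] [DecidableEq m] (A : Matrix m m ℝ) : ℝ :=
  sSup (spectrum ℝ A)

/-- The matrix `n⁻¹ X_ηᵀ (Iₙ - P_γ) X_η`. -/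
def residGram {n p : ℕ} (X : Matrix (Fin n) (Fin p) ℝ) (η γ : Finset (Fin p)) :
    Matrix η η ℝ :=
  (1 / (n : ℝ)) • ((cols X η)ᵀ * (1 - proj X γ) * cols X η)

/-- `φ_min(n)`, the minimum over `γ ∈ S₂` of
`λ₋(n⁻¹ X_{γ₀ \ γ}ᵀ (Iₙ - P_γ) X_{γ₀ \ γ})`. -/
def phiMin {n p : ℕ} (γ₀ : Finset (Fin p)) (X : Matrix (Fin n) (Fin p) ℝ) : ℝ :=
  ⨅ γ : S₂ γ₀, eigMin (residGram X (γ₀ \ (γ : Finset (Fin p))) γ)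

/-- `φ_max(n)`, the maximum over `γ ∈ S₂` of `λ₊(n⁻¹ X_{γ₀ \ γ}ᵀ X_{γ₀ \ γ})`. -/
def phiMax {n p : ℕ} (γ₀ : Finset (Fin p)) (X : Matrix (Fin n) (Fin p) ℝ) : ℝ :=
  ⨆ γ : S₂ γ₀, eigMax ((1 / (n : ℝ)) •
    ((cols X (γ₀ \ (γ : Finset (Fin p))))ᵀ * cols X (γ₀ \ (γ : Finset (Fin p)))))

/-- `Σ_γ = diag (c_j : j ∈ γ)`. -/
def sigmaMat {p : ℕ} (c : Fin p → ℝ) (γ : Finset (Fin p)) : Matrix γ γ ℝ :=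
  Matrix.diagonal fun j : γ => c j

/-- `Σ_γ^{1/2}`. -/
def sigmaSqrt {p : ℕ} (c : Fin p → ℝ) (γ : Finset (Fin p)) : Matrix γ γ ℝ :=
  Matrix.diagonal fun j : γ => Real.sqrt (c j)

/-- `U_γ = Σ_γ⁻¹ + X_γᵀ X_γ`. -/
def uMat {n p : ℕ} (c : Fin p → ℝ) (X : Matrix (Fin n) (Fin p) ℝ) (γ : Finset (Fin p)) :
    Matrix γ γ ℝ :=
  (sigmaMat c γ)⁻¹ + (cols X γ)ᵀ * cols X γ

/-- `W_γ = Σ_γ^{1/2} U_γ Σ_γ^{1/2}`. -/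
def wMat {n p : ℕ} (c : Fin p → ℝ) (X : Matrix (Fin n) (Fin p) ℝ) (γ : Finset (Fin p)) :
    Matrix γ γ ℝ :=
  sigmaSqrt c γ * uMat c X γ * sigmaSqrt c γ

/-- The unnormalized posterior weight of the model `γ` given the data `(y, X)`,
`(2π)^{-n/2} det(W_γ)^{-1/2} p(γ) {2 / (1 + yᵀ (Iₙ - X_γ U_γ⁻¹ X_γᵀ) y)}^{(n+ν)/2}`. For the empty
model the determinant is `1` and the quadratic form is `yᵀ y`. -/
def postWeight {n p : ℕ} (ν : ℝ) (prior : PMF (Finset (Fin p))) (c : Fin p → ℝ)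
    (X : Matrix (Fin n) (Fin p) ℝ) (y : Fin n → ℝ) (γ : Finset (Fin p)) : ℝ :=
  (2 * Real.pi) ^ (-(n : ℝ) / 2) * (wMat c X γ).det ^ (-(1 / 2) : ℝ) * (prior γ).toReal *
    (2 / (1 + y ⬝ᵥ ((1 - cols X γ * (uMat c X γ)⁻¹ * (cols X γ)ᵀ) *ᵥ y))) ^ (((n : ℝ) + ν) / 2)

/-- The posterior probability `p(γ | Z)` of the model `γ` given the data `Z = (y, X)`. -/
def posterior {n p : ℕ} (ν : ℝ) (prior : PMF (Finset (Fin p))) (c : Fin p → ℝ)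
    (X : Matrix (Fin n) (Fin p) ℝ) (y : Fin n → ℝ) (γ : Finset (Fin p)) : ℝ :=
  postWeight ν prior c X y γ / ∑ γ' : Finset (Fin p), postWeight ν prior c X y γ'

end

end BayesSel

/-
The posterior odds of `γ` against `γ₀` are a ratio of determinants times a power close to `n / 2` of
a ratio of penalized residual sums of squares. For `γ ⊋ γ₀`, each extra column contributes a factor
of order at most `n ^ (-(1 - δ + δ₀) / 2)` through the determinants, while its chance gain in the
residual sum of squares exceeds `2 (1 + a) σ₀² log n` for some `γ` only with vanishing probability,
so that it wins back a factor close to `n`; since `3 + δ < δ₀`, the odds are at most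
`n ^ (-(1 + η))` per column, and their sum over all `γ ⊋ γ₀` is of order `p n ^ (-(1 + η))`. A model
missing some true column has a residual sum of squares larger by a positive multiple of `n`, hence
exponentially small odds, which beat both the `2 ^ p` models and determinants of order `n ^ O(p)`
because `p log n = o(n)`. All probability bounds are conditional on the design, on which the
projections do not depend on the noise.
-/

namespace BayesSel

open scoped MatrixOrder

section LoewnerOrder

variable {m n : Type*}

theorem isHermitian_of_smul_one_le [DecidableEq m] {A : Matrix m m ℝ} {c : ℝ}
    (h : c • (1 : Matrix m m ℝ) ≤ A) : A.IsHermitian := by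
  simpa using (le_iff.1 h).isHermitian.add (isHermitian_one.smul (.all c))

theorem posDef_of_smul_one_le [DecidableEq m] {A : Matrix m m ℝ} {c : ℝ} (hc : 0 < c)
    (h : c • (1 : Matrix m m ℝ) ≤ A) : A.PosDef := by
  simpa using (PosDef.one.smul hc).add_posSemidef (le_iff.1 h)

variable [Fintype n]

theorem transpose_mul_mul_mono [Finite m] {A B : Matrix n n ℝ} (h : A ≤ B) (C : Matrix n m ℝ) :
    Cᵀ * A * C ≤ Cᵀ * B * C := by
  have := (le_iff.1 h).conjTranspose_mul_mul_same C
  rwa [conjTranspose_eq_transpose_of_trivial, Matrix.mul_sub, Matrix.sub_mul, ← le_iff] at this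

variable [Fintype m]

theorem dotProduct_mulVec_mono {A B : Matrix m m ℝ} (h : A ≤ B) (v : m → ℝ) :
    v ⬝ᵥ (A *ᵥ v) ≤ v ⬝ᵥ (B *ᵥ v) := by
  have := (le_iff.1 h).dotProduct_mulVec_nonneg v
  rwa [star_trivial, sub_mulVec, dotProduct_sub, sub_nonneg] at this

theorem dotProduct_transpose_mul_mul_mulVec (A : Matrix n n ℝ) (C : Matrix n m ℝ) (v : m → ℝ) :
    v ⬝ᵥ ((Cᵀ * A * C) *ᵥ v) = (C *ᵥ v) ⬝ᵥ (A *ᵥ (C *ᵥ v)) := by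
  rw [← mulVec_mulVec, ← mulVec_mulVec, dotProduct_mulVec v, vecMul_transpose]

theorem dotProduct_transpose_mul_mulVec (C : Matrix n m ℝ) (v : m → ℝ) :
    v ⬝ᵥ ((Cᵀ * C) *ᵥ v) = (C *ᵥ v) ⬝ᵥ (C *ᵥ v) := by
  rw [← mulVec_mulVec, dotProduct_mulVec, vecMul_transpose]

theorem dotProduct_self_add_le (a b : m → ℝ) :
    (a + b) ⬝ᵥ (a + b) ≤ 2 * (a ⬝ᵥ a) + 2 * (b ⬝ᵥ b) := by
  simp only [dotProduct, Finset.mul_sum, ← Finset.sum_add_distrib, Pi.add_apply]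
  exact Finset.sum_le_sum fun i _ => by linarith [mul_self_nonneg (a i - b i)]

variable [DecidableEq m]

theorem smul_one_le_of_le_eigMin {A : Matrix m m ℝ} (hA : A.IsHermitian) {c : ℝ}
    (hc : c ≤ eigMin A) : c • (1 : Matrix m m ℝ) ≤ A := by
  rw [← Algebra.algebraMap_eq_smul_one, algebraMap_le_iff_le_spectrum hA.isSelfAdjoint]
  exact fun x hx => hc.trans (csInf_le finite_real_spectrum.bddBelow hx)

theorem le_smul_one_of_eigMax_le {A : Matrix m m ℝ} (hA : A.IsHermitian) {c : ℝ}
    (hc : eigMax A ≤ c) : A ≤ c • (1 : Matrix m m ℝ) := by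
  rw [← Algebra.algebraMap_eq_smul_one, le_algebraMap_iff_spectrum_le hA.isSelfAdjoint]
  exact fun x hx => (le_csSup finite_real_spectrum.bddAbove hx).trans hc

theorem pow_card_le_det {A : Matrix m m ℝ} {c : ℝ} (hc : 0 ≤ c)
    (h : c • (1 : Matrix m m ℝ) ≤ A) : c ^ Fintype.card m ≤ A.det := by
  have hA := isHermitian_of_smul_one_le h
  rw [← Algebra.algebraMap_eq_smul_one, algebraMap_le_iff_le_spectrum hA.isSelfAdjoint] at h
  rw [hA.det_eq_prod_eigenvalues, ← Finset.card_univ, ← Finset.prod_const]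
  exact Finset.prod_le_prod (fun _ _ => hc) fun i _ => h _ (hA.eigenvalues_mem_spectrum_real i)

theorem det_le_pow_card {A : Matrix m m ℝ} (hA : A.PosSemidef) {c : ℝ}
    (h : A ≤ c • (1 : Matrix m m ℝ)) : A.det ≤ c ^ Fintype.card m := by
  rw [← Algebra.algebraMap_eq_smul_one,
    le_algebraMap_iff_spectrum_le hA.isHermitian.isSelfAdjoint] at h
  rw [hA.isHermitian.det_eq_prod_eigenvalues, ← Finset.card_univ, ← Finset.prod_const]
  exact Finset.prod_le_prod (fun i _ => hA.eigenvalues_nonneg i)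
    fun i _ => h _ (hA.isHermitian.eigenvalues_mem_spectrum_real i)

end LoewnerOrder

section StarProjection

variable {m n : Type*} [Fintype m] {P : Matrix m m ℝ}

theorem transpose_eq_of_isStarProjection (hP : IsStarProjection P) : Pᵀ = P := by
  simpa [star_eq_conjTranspose] using hP.isSelfAdjoint.star_eq

theorem dotProduct_mulVec_self_of_isStarProjection (hP : IsStarProjection P) (v : m → ℝ) :
    (P *ᵥ v) ⬝ᵥ (P *ᵥ v) = v ⬝ᵥ (P *ᵥ v) := by
  rw [← dotProduct_transpose_mul_mulVec, transpose_eq_of_isStarProjection hP,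
    hP.isIdempotentElem.eq]

theorem dotProduct_mulVec_le_of_isStarProjection (hP : IsStarProjection P) (v : m → ℝ) :
    v ⬝ᵥ (P *ᵥ v) ≤ v ⬝ᵥ v := by
  classical
  simpa using dotProduct_mulVec_mono hP.le_one v

end StarProjection

section Ridge

variable {m n : Type*} {S : Matrix m m ℝ}

theorem posDef_add_gram [Finite m] [Fintype n] (hS : S.PosDef) (X : Matrix n m ℝ) :
    (S + Xᵀ * X).PosDef := by
  simpa using hS.add_posSemidef (posSemidef_conjTranspose_mul_self X)

variable [Fintype m] [DecidableEq n]

theorem posDef_one_add_mul_mul_transpose [Finite n] (hS : S.PosDef) (X : Matrix n m ℝ) :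
    (1 + X * S * Xᵀ).PosDef := by
  simpa using PosDef.one.add_posSemidef (hS.posSemidef.mul_mul_conjTranspose_same X)

variable [Fintype n] [DecidableEq m]

theorem inv_one_add_mul_mul_transpose (hS : S.PosDef) (X : Matrix n m ℝ) :
    (1 + X * S * Xᵀ)⁻¹ = 1 - X * (S⁻¹ + Xᵀ * X)⁻¹ * Xᵀ := by
  simpa using add_mul_mul_inv_eq_sub 1 X S Xᵀ isUnit_one hS.isUnit
    (by simpa using (posDef_add_gram hS.inv X).isUnit)

omit [DecidableEq m] in
/-- Compressing `X (S⁻¹ + XᵀX)⁻¹ Xᵀ ≤ 1` by `P` leaves the left side unchanged. -/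
theorem one_sub_le_inv_one_add_mul_mul_transpose (hS : S.PosDef) {X : Matrix n m ℝ}
    {P : Matrix n n ℝ} (hP : IsStarProjection P) (hPX : P * X = X) :
    1 - P ≤ (1 + X * S * Xᵀ)⁻¹ := by
  classical
  have hinv := inv_one_add_mul_mul_transpose hS X
  set H := X * (S⁻¹ + Xᵀ * X)⁻¹ * Xᵀ with hH
  have hH1 : H ≤ 1 := by
    rw [le_iff, ← hinv]
    exact (posDef_one_add_mul_mul_transpose hS X).inv.posSemidef
  have hPt := transpose_eq_of_isStarProjection hP
  have hXP : Xᵀ * P = Xᵀ := by simpa [hPt] using congrArg transpose hPX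
  have hPHP : Pᵀ * H * P = H := by
    rw [hPt, hH, ← Matrix.mul_assoc, ← Matrix.mul_assoc, hPX, Matrix.mul_assoc, hXP]
  have hHP := transpose_mul_mul_mono hH1 P
  rw [hPHP, Matrix.mul_one, hPt, hP.isIdempotentElem.eq] at hHP
  exact hinv ▸ sub_le_sub_left hHP 1

/-- Ridge regression minimizes `b ↦ |y - X b|² + bᵀ S⁻¹ b`, with minimum
`yᵀ (1 - X (S⁻¹ + XᵀX)⁻¹ Xᵀ) y`. -/
theorem dotProduct_inv_one_add_mulVec_le (hS : S.PosDef) (X : Matrix n m ℝ) (y : n → ℝ)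
    (b : m → ℝ) :
    y ⬝ᵥ ((1 + X * S * Xᵀ)⁻¹ *ᵥ y) ≤
      (y - X *ᵥ b) ⬝ᵥ (y - X *ᵥ b) + b ⬝ᵥ (S⁻¹ *ᵥ b) := by
  have hU := posDef_add_gram hS.inv X
  have := hU.isUnit.invertible
  have hsquare := schur_complement_eq₂₂ 1 (-X) y b hU.isHermitian
  have hnonneg := hU.posSemidef.dotProduct_mulVec_nonneg
    (((S⁻¹ + Xᵀ * X)⁻¹ * (-X)ᴴ) *ᵥ y + b)
  have hform : star (y ⊕ᵥ b) ᵥ* fromBlocks 1 (-X) (-X)ᴴ (S⁻¹ + Xᵀ * X) ⬝ᵥ (y ⊕ᵥ b) =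
      (y - X *ᵥ b) ⬝ᵥ (y - X *ᵥ b) + b ⬝ᵥ (S⁻¹ *ᵥ b) := by
    simp only [star_trivial, ← dotProduct_mulVec, fromBlocks_mulVec, Sum.elim_comp_inl,
      Sum.elim_comp_inr, sumElim_dotProduct_sumElim, one_mulVec, neg_mulVec, dotProduct_add,
      dotProduct_neg, conjTranspose_eq_transpose_of_trivial, transpose_neg, mulVec_transpose,
      add_mulVec, dotProduct_transpose_mul_mulVec, sub_dotProduct, dotProduct_sub]
    rw [dotProduct_comm b (y ᵥ* X), ← dotProduct_mulVec, dotProduct_comm (X *ᵥ b) y]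
    ring
  rw [star_trivial, conjTranspose_eq_transpose_of_trivial, transpose_neg] at hnonneg
  rw [hform, star_trivial, star_trivial, ← dotProduct_mulVec, ← dotProduct_mulVec,
    conjTranspose_eq_transpose_of_trivial, transpose_neg] at hsquare
  rw [hsquare, inv_one_add_mul_mul_transpose hS, Matrix.neg_mul, Matrix.neg_mul,
    Matrix.mul_neg (_ * _), neg_neg]
  exact le_add_of_nonneg_left hnonneg

end Ridge

section StarProjectionForms

variable {m : Type*} [Fintype m] {P Q D : Matrix m m ℝ}

theorem dotProduct_mulVec_add_of_mulVec_eq_zero (hD : IsStarProjection D) {x : m → ℝ}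
    (hx : D *ᵥ x = 0) (e : m → ℝ) : (x + e) ⬝ᵥ (D *ᵥ (x + e)) = e ⬝ᵥ (D *ᵥ e) := by
  rw [← dotProduct_mulVec_self_of_isStarProjection hD, mulVec_add, hx, zero_add,
    dotProduct_mulVec_self_of_isStarProjection hD]

theorem dotProduct_mulVec_le_two_mul_add (hD : IsStarProjection D) (x e : m → ℝ) :
    x ⬝ᵥ (D *ᵥ x) ≤ 2 * ((x + e) ⬝ᵥ (D *ᵥ (x + e))) + 2 * (e ⬝ᵥ (D *ᵥ e)) := by
  have h := dotProduct_self_add_le (D *ᵥ (x + e)) (-(D *ᵥ e))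
  rwa [← sub_eq_add_neg, ← mulVec_sub, add_sub_cancel_right, neg_dotProduct_neg,
    dotProduct_mulVec_self_of_isStarProjection hD, dotProduct_mulVec_self_of_isStarProjection hD,
    dotProduct_mulVec_self_of_isStarProjection hD] at h

/-- Split `1 - P = (Q - P) + (1 - Q)`: the signal `x` is seen only by `Q - P`. -/
theorem dotProduct_one_sub_mulVec_add_ge [DecidableEq m] (hP : IsStarProjection P)
    (hQ : IsStarProjection Q) (hQP : Q * P = P) {x : m → ℝ} (hx : Q *ᵥ x = x) (e : m → ℝ) :
    e ⬝ᵥ e + (x ⬝ᵥ ((1 - P) *ᵥ x)) / 2 - 2 * (e ⬝ᵥ (Q *ᵥ e)) ≤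
      (x + e) ⬝ᵥ ((1 - P) *ᵥ (x + e)) := by
  have hsplit : 1 - P = (Q - P) + (1 - Q) := by abel
  have hQx : (1 - Q) *ᵥ x = 0 := by rw [sub_mulVec, one_mulVec, hx, sub_self]
  have hsignal : x ⬝ᵥ ((1 - P) *ᵥ x) = x ⬝ᵥ ((Q - P) *ᵥ x) := by
    rw [hsplit, add_mulVec, hQx, add_zero]
  have htotal : (x + e) ⬝ᵥ ((1 - P) *ᵥ (x + e)) =
      (x + e) ⬝ᵥ ((Q - P) *ᵥ (x + e)) + (e ⬝ᵥ e - e ⬝ᵥ (Q *ᵥ e)) := by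
    rw [hsplit, add_mulVec, dotProduct_add, dotProduct_mulVec_add_of_mulVec_eq_zero hQ.one_sub hQx,
      sub_mulVec 1 Q, one_mulVec, dotProduct_sub]
  have hdiff := dotProduct_mulVec_le_two_mul_add (hP.sub_of_mul_eq_right hQ hQP) x e
  have hnoise : e ⬝ᵥ ((Q - P) *ᵥ e) ≤ e ⬝ᵥ (Q *ᵥ e) :=
    dotProduct_mulVec_mono (sub_le_self Q hP.nonneg) e
  linarith

end StarProjectionForms

section Design

variable {n p : ℕ}

theorem cols_mulVec_restrict (X : Matrix (Fin n) (Fin p) ℝ) (γ : Finset (Fin p))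
    (b : Fin p → ℝ) : cols X γ *ᵥ γ.restrict b = fun i => ∑ j ∈ γ, X i j * b j :=
  funext fun i => Finset.sum_coe_sort γ fun j => X i j * b j

theorem cols_mulVec_restrict_of_support (X : Matrix (Fin n) (Fin p) ℝ) {γ : Finset (Fin p)}
    {b : Fin p → ℝ} (hb : ∀ j ∉ γ, b j = 0) : cols X γ *ᵥ γ.restrict b = X *ᵥ b := by
  rw [cols_mulVec_restrict]
  exact funext fun i => Finset.sum_subset (Finset.subset_univ γ) fun j _ hj => by
    rw [hb j hj, mul_zero]

theorem cols_mulVec_restrict_add_sdiff (X : Matrix (Fin n) (Fin p) ℝ) (γ γ' : Finset (Fin p))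
    {b : Fin p → ℝ} (hb : ∀ j ∉ γ', b j = 0) :
    cols X γ *ᵥ γ.restrict b + cols X (γ' \ γ) *ᵥ (γ' \ γ).restrict b = X *ᵥ b := by
  rw [← cols_mulVec_restrict_of_support (γ := γ ∪ γ') X fun j hj =>
    hb j fun h => hj (Finset.mem_union_right γ h)]
  simp only [cols_mulVec_restrict]
  funext i
  rw [← Finset.union_sdiff_self_eq_union, Finset.sum_union Finset.disjoint_sdiff]
  rfl

theorem mulVec_injective_cols {X : Matrix (Fin n) (Fin p) ℝ} (hX : Function.Injective X.mulVec)
    (γ : Finset (Fin p)) : Function.Injective (cols X γ).mulVec :=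
  mulVec_injective_iff.2 ((mulVec_injective_iff.1 hX).comp _ Subtype.val_injective)

theorem mulVec_injective_iff_isUnit_det_gram {m k : Type*} [Fintype m] [Fintype k] [DecidableEq k]
    {A : Matrix m k ℝ} : Function.Injective A.mulVec ↔ IsUnit (Aᵀ * A).det := by
  rw [← isUnit_iff_isUnit_det, ← mulVec_injective_iff_isUnit]
  change Function.Injective A.mulVecLin ↔ Function.Injective (Aᵀ * A).mulVecLin
  rw [← LinearMap.ker_eq_bot, ← LinearMap.ker_eq_bot, ker_mulVecLin_transpose_mul_self]

theorem proj_transpose (X : Matrix (Fin n) (Fin p) ℝ) (γ : Finset (Fin p)) :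
    (proj X γ)ᵀ = proj X γ := by
  simp only [proj, transpose_mul, transpose_transpose, transpose_nonsing_inv, Matrix.mul_assoc]

theorem proj_mul_cols {X : Matrix (Fin n) (Fin p) ℝ} {γ : Finset (Fin p)}
    (h : Function.Injective (cols X γ).mulVec) : proj X γ * cols X γ = cols X γ := by
  rw [proj, Matrix.mul_assoc, Matrix.mul_assoc,
    nonsing_inv_mul _ (mulVec_injective_iff_isUnit_det_gram.1 h), Matrix.mul_one]

/-- When the Gram matrix is singular its `⁻¹`, hence the whole projection, is `0`. -/
theorem isStarProjection_proj (X : Matrix (Fin n) (Fin p) ℝ) (γ : Finset (Fin p)) :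
    IsStarProjection (proj X γ) where
  isSelfAdjoint := by
    rw [IsSelfAdjoint, star_eq_conjTranspose, conjTranspose_eq_transpose_of_trivial,
      proj_transpose]
  isIdempotentElem := by
    by_cases h : IsUnit ((cols X γ)ᵀ * cols X γ).det
    · have hinj := mulVec_injective_iff_isUnit_det_gram.2 h
      rw [IsIdempotentElem]
      nth_rewrite 2 [proj]
      rw [← Matrix.mul_assoc, ← Matrix.mul_assoc, proj_mul_cols hinj, proj]
    · rw [proj, nonsing_inv_apply_not_isUnit _ h, Matrix.mul_zero, Matrix.zero_mul]
      exact .zero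

theorem trace_proj {X : Matrix (Fin n) (Fin p) ℝ} {γ : Finset (Fin p)}
    (h : Function.Injective (cols X γ).mulVec) : (proj X γ).trace = γ.card := by
  rw [proj, trace_mul_cycle, mul_nonsing_inv _ (mulVec_injective_iff_isUnit_det_gram.1 h),
    trace_one, Fintype.card_coe]

theorem proj_mul_cols_of_subset {X : Matrix (Fin n) (Fin p) ℝ} {γ γ' : Finset (Fin p)}
    (h : Function.Injective (cols X γ').mulVec) (hs : γ ⊆ γ') :
    proj X γ' * cols X γ = cols X γ := by
  ext i j
  exact congrFun (congrFun (proj_mul_cols h) i) ⟨j, hs j.2⟩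

theorem proj_mul_proj_of_subset {X : Matrix (Fin n) (Fin p) ℝ} {γ γ' : Finset (Fin p)}
    (h : Function.Injective (cols X γ').mulVec) (hs : γ ⊆ γ') :
    proj X γ' * proj X γ = proj X γ := by
  rw [proj.eq_1 X γ, ← Matrix.mul_assoc, ← Matrix.mul_assoc, proj_mul_cols_of_subset h hs]

theorem proj_mulVec_mulVec {X : Matrix (Fin n) (Fin p) ℝ} {γ : Finset (Fin p)}
    (h : Function.Injective (cols X γ).mulVec) {b : Fin p → ℝ} (hb : ∀ j ∉ γ, b j = 0) :
    proj X γ *ᵥ (X *ᵥ b) = X *ᵥ b := by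
  rw [← cols_mulVec_restrict_of_support X hb, mulVec_mulVec, proj_mul_cols h]

theorem one_sub_proj_mulVec_mulVec {X : Matrix (Fin n) (Fin p) ℝ} {γ : Finset (Fin p)}
    (h : Function.Injective (cols X γ).mulVec) {γ' : Finset (Fin p)} {b : Fin p → ℝ}
    (hb : ∀ j ∉ γ', b j = 0) :
    (1 - proj X γ) *ᵥ (X *ᵥ b) =
      (1 - proj X γ) *ᵥ (cols X (γ' \ γ) *ᵥ (γ' \ γ).restrict b) := by
  rw [← cols_mulVec_restrict_add_sdiff X γ γ' hb, mulVec_add, mulVec_mulVec, Matrix.sub_mul,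
    Matrix.one_mul, proj_mul_cols h, sub_self, zero_mulVec, zero_add]

theorem mulVec_injective_of_posDef {X : Matrix (Fin n) (Fin p) ℝ} {γ : Finset (Fin p)}
    (hγ : Function.Injective (cols X γ).mulVec)
    (hres : ((cols X (Finset.univ \ γ))ᵀ * (1 - proj X γ) * cols X (Finset.univ \ γ)).PosDef) :
    Function.Injective X.mulVec := by
  refine (injective_iff_map_eq_zero X.mulVecLin).2 fun b hb => ?_
  rw [mulVecLin_apply] at hb
  have hb' : ∀ j ∉ (Finset.univ : Finset (Fin p)), b j = 0 := fun j hj =>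
    absurd (Finset.mem_univ j) hj
  have hcompl : (Finset.univ \ γ).restrict b = 0 := by
    refine mulVec_injective_iff_isUnit.2 hres.isUnit ?_
    rw [mulVec_zero, ← mulVec_mulVec, ← mulVec_mulVec, ← one_sub_proj_mulVec_mulVec hγ hb', hb,
      mulVec_zero, mulVec_zero]
  have hmem : γ.restrict b = 0 := by
    refine hγ ?_
    rw [mulVec_zero, ← hb, ← cols_mulVec_restrict_add_sdiff X γ _ hb', hcompl, mulVec_zero,
      add_zero]
  funext j
  by_cases hj : j ∈ γ
  · exact congrFun hmem ⟨j, hj⟩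
  · exact congrFun hcompl ⟨j, Finset.mem_sdiff.2 ⟨Finset.mem_univ j, hj⟩⟩

end Design

section MarginalCovariance

variable {n p : ℕ}

/-- The covariance matrix `Iₙ + X_γ Σ_γ X_γᵀ` of `y` given `γ` and a unit error variance, once the
coefficients with prior `N(0, Σ_γ)` are integrated out. -/
noncomputable def margCov (c : Fin p → ℝ) (X : Matrix (Fin n) (Fin p) ℝ) (γ : Finset (Fin p)) :
    Matrix (Fin n) (Fin n) ℝ :=
  1 + cols X γ * sigmaMat c γ * (cols X γ)ᵀ

/-- The penalized residual sum of squares `yᵀ (Iₙ + X_γ Σ_γ X_γᵀ)⁻¹ y` of the model `γ`, which is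
the quadratic form `yᵀ (Iₙ - X_γ U_γ⁻¹ X_γᵀ) y` of the posterior weight. -/
noncomputable def penalizedRss (c : Fin p → ℝ) (X : Matrix (Fin n) (Fin p) ℝ) (y : Fin n → ℝ)
    (γ : Finset (Fin p)) : ℝ :=
  y ⬝ᵥ ((margCov c X γ)⁻¹ *ᵥ y)

theorem posDef_sigmaMat {c : Fin p → ℝ} (hc : ∀ j, 0 < c j) (γ : Finset (Fin p)) :
    (sigmaMat c γ).PosDef :=
  PosDef.diagonal fun j => hc j

theorem smul_one_le_sigmaMat {c : Fin p → ℝ} {t : ℝ} (ht : ∀ j, t ≤ c j) (γ : Finset (Fin p)) :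
    t • 1 ≤ sigmaMat c γ := by
  rw [le_iff, sigmaMat, smul_one_eq_diagonal, diagonal_sub]
  exact PosSemidef.diagonal fun j => sub_nonneg.2 (ht j)

theorem sigmaMat_le_smul_one {c : Fin p → ℝ} {t : ℝ} (ht : ∀ j, c j ≤ t) (γ : Finset (Fin p)) :
    sigmaMat c γ ≤ t • 1 := by
  rw [le_iff, sigmaMat, smul_one_eq_diagonal, diagonal_sub]
  exact PosSemidef.diagonal fun j => sub_nonneg.2 (ht j)

theorem sigmaMat_inv_le {c : Fin p → ℝ} {t : ℝ} (ht : 0 < t) (htc : ∀ j, t ≤ c j)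
    (γ : Finset (Fin p)) : (sigmaMat c γ)⁻¹ ≤ t⁻¹ • 1 := by
  have hinv : (sigmaMat c γ)⁻¹ = sigmaMat (fun j => (c j)⁻¹) γ := by
    refine inv_eq_left_inv ?_
    rw [sigmaMat, sigmaMat, diagonal_mul_diagonal, ← diagonal_one]
    exact congrArg diagonal (funext fun j => inv_mul_cancel₀ (ht.trans_le (htc j)).ne')
  exact hinv ▸ sigmaMat_le_smul_one (fun j => inv_anti₀ ht (htc j)) γ

theorem sigmaSqrt_transpose (c : Fin p → ℝ) (γ : Finset (Fin p)) :
    (sigmaSqrt c γ)ᵀ = sigmaSqrt c γ :=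
  diagonal_transpose _

theorem sigmaSqrt_mul_sigmaSqrt {c : Fin p → ℝ} (hc : ∀ j, 0 ≤ c j) (γ : Finset (Fin p)) :
    sigmaSqrt c γ * sigmaSqrt c γ = sigmaMat c γ := by
  rw [sigmaSqrt, diagonal_mul_diagonal, sigmaMat]
  exact congrArg diagonal (funext fun j => Real.mul_self_sqrt (hc j))

theorem mul_sigmaMat_mul_transpose {c : Fin p → ℝ} (hc : ∀ j, 0 ≤ c j)
    (X : Matrix (Fin n) (Fin p) ℝ) (γ : Finset (Fin p)) :
    cols X γ * sigmaMat c γ * (cols X γ)ᵀ =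
      (cols X γ * sigmaSqrt c γ) * (cols X γ * sigmaSqrt c γ)ᵀ := by
  simp only [transpose_mul, sigmaSqrt_transpose, ← sigmaSqrt_mul_sigmaSqrt hc, Matrix.mul_assoc]

theorem wMat_eq_one_add {c : Fin p → ℝ} (hc : ∀ j, 0 < c j) (X : Matrix (Fin n) (Fin p) ℝ)
    (γ : Finset (Fin p)) :
    wMat c X γ = 1 + (cols X γ * sigmaSqrt c γ)ᵀ * (cols X γ * sigmaSqrt c γ) := by
  have hinv : (sigmaMat c γ)⁻¹ = (sigmaSqrt c γ)⁻¹ * (sigmaSqrt c γ)⁻¹ := by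
    rw [← Matrix.mul_inv_rev, sigmaSqrt_mul_sigmaSqrt fun j => (hc j).le]
  have hdet : IsUnit (sigmaSqrt c γ).det := (isUnit_iff_isUnit_det _).1
    (PosDef.diagonal fun j : γ => Real.sqrt_pos.2 (hc j)).isUnit
  rw [wMat, uMat, Matrix.mul_add, Matrix.add_mul, hinv, ← Matrix.mul_assoc, mul_nonsing_inv _ hdet,
    Matrix.one_mul, nonsing_inv_mul _ hdet, transpose_mul, sigmaSqrt_transpose]
  simp only [Matrix.mul_assoc]

theorem posDef_margCov {c : Fin p → ℝ} (hc : ∀ j, 0 < c j) (X : Matrix (Fin n) (Fin p) ℝ)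
    (γ : Finset (Fin p)) : (margCov c X γ).PosDef :=
  posDef_one_add_mul_mul_transpose (posDef_sigmaMat hc γ) _

theorem margCov_inv {c : Fin p → ℝ} (hc : ∀ j, 0 < c j) (X : Matrix (Fin n) (Fin p) ℝ)
    (γ : Finset (Fin p)) :
    (margCov c X γ)⁻¹ = 1 - cols X γ * (uMat c X γ)⁻¹ * (cols X γ)ᵀ :=
  inv_one_add_mul_mul_transpose (posDef_sigmaMat hc γ) _

theorem margCov_eq_add (c : Fin p → ℝ) (X : Matrix (Fin n) (Fin p) ℝ) {γ₀ γ : Finset (Fin p)}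
    (h : γ₀ ⊆ γ) :
    margCov c X γ = margCov c X γ₀ +
      cols X (γ \ γ₀) * sigmaMat c (γ \ γ₀) * (cols X (γ \ γ₀))ᵀ := by
  have hentry (s : Finset (Fin p)) (i k : Fin n) :
      (cols X s * sigmaMat c s * (cols X s)ᵀ) i k = ∑ j ∈ s, X i j * c j * X k j := by
    rw [mul_apply]
    simp only [sigmaMat, mul_diagonal, transpose_apply, cols, submatrix_apply, id]
    exact Finset.sum_coe_sort s fun j => X i j * c j * X k j
  ext i k
  simp only [margCov, Matrix.add_apply, hentry, add_assoc,
    ← Finset.sum_sdiff h (f := fun j => X i j * c j * X k j),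
    add_comm (∑ j ∈ γ \ γ₀, X i j * c j * X k j)]

end MarginalCovariance

section Determinant

variable {n p : ℕ} {c : Fin p → ℝ}

theorem det_margCov (hc : ∀ j, 0 < c j) (X : Matrix (Fin n) (Fin p) ℝ) (γ : Finset (Fin p)) :
    (margCov c X γ).det = (wMat c X γ).det := by
  rw [wMat_eq_one_add hc, det_one_add_mul_comm, margCov,
    mul_sigmaMat_mul_transpose fun j => (hc j).le]

theorem one_le_det_margCov (hc : ∀ j, 0 < c j) (X : Matrix (Fin n) (Fin p) ℝ)
    (γ : Finset (Fin p)) : 1 ≤ (margCov c X γ).det := by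
  rw [← one_pow (Fintype.card (Fin n))]
  refine pow_card_le_det zero_le_one ?_
  rw [one_smul, margCov, mul_sigmaMat_mul_transpose fun j => (hc j).le]
  exact le_add_of_nonneg_right
    (by simpa using (posSemidef_self_mul_conjTranspose (cols X γ * sigmaSqrt c γ)).nonneg)

theorem det_margCov_le (hc : ∀ j, 0 < c j) {t g : ℝ} (ht : ∀ j, c j ≤ t) (hg : 0 ≤ g)
    {X : Matrix (Fin n) (Fin p) ℝ} {γ : Finset (Fin p)}
    (hgram : (cols X γ)ᵀ * cols X γ ≤ g • 1) : (margCov c X γ).det ≤ (1 + g * t) ^ γ.card := by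
  have hW : wMat c X γ ≤ (1 + g * t) • 1 := by
    rw [wMat_eq_one_add hc, add_smul, one_smul, transpose_mul, Matrix.mul_assoc,
      ← Matrix.mul_assoc _ (cols X γ), ← Matrix.mul_assoc]
    refine add_le_add le_rfl ((transpose_mul_mul_mono hgram _).trans ?_)
    rw [sigmaSqrt_transpose, Matrix.mul_smul, Matrix.mul_one, Matrix.smul_mul,
      sigmaSqrt_mul_sigmaSqrt fun j => (hc j).le, mul_smul]
    exact smul_le_smul_of_nonneg_left (sigmaMat_le_smul_one ht γ) hg
  have hpos : (wMat c X γ).PosSemidef := by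
    rw [wMat_eq_one_add hc]
    exact (posDef_add_gram PosDef.one _).posSemidef
  rw [det_margCov hc, ← Fintype.card_coe γ]
  exact det_le_pow_card hpos hW

/-- By the matrix determinant lemma the quotient of the two determinants is
`det (1 + Bᵀ (margCov c X γ₀)⁻¹ B)` with `B = X_{γ \ γ₀} Σ_{γ \ γ₀}^{1/2}`. -/
theorem det_margCov_mul_le {t g : ℝ} (ht : 0 < t) (htc : ∀ j, t ≤ c j) (hg : 0 ≤ g)
    {X : Matrix (Fin n) (Fin p) ℝ} {γ₀ γ : Finset (Fin p)} (hs : γ₀ ⊆ γ)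
    (hγ₀ : Function.Injective (cols X γ₀).mulVec)
    (hres : g • 1 ≤ (cols X (γ \ γ₀))ᵀ * (1 - proj X γ₀) * cols X (γ \ γ₀)) :
    (margCov c X γ₀).det * (g * t) ^ (γ \ γ₀).card ≤ (margCov c X γ).det := by
  have hc (j : Fin p) : 0 < c j := ht.trans_le (htc j)
  have hc' (j : Fin p) : 0 ≤ c j := (hc j).le
  set η := γ \ γ₀
  set B := cols X η * sigmaSqrt c η with hB
  have hM := posDef_margCov hc X γ₀
  have hquot : (g * t) • 1 ≤ 1 + Bᵀ * (margCov c X γ₀)⁻¹ * B := calc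
    (g * t) • 1 ≤ g • sigmaMat c η := by
        rw [mul_smul]
        exact smul_le_smul_of_nonneg_left (smul_one_le_sigmaMat htc η) hg
    _ = (sigmaSqrt c η)ᵀ * (g • 1) * sigmaSqrt c η := by
        rw [sigmaSqrt_transpose, Matrix.mul_smul, Matrix.mul_one, Matrix.smul_mul,
          sigmaSqrt_mul_sigmaSqrt hc']
    _ ≤ Bᵀ * (1 - proj X γ₀) * B := by
        simpa only [hB, transpose_mul, Matrix.mul_assoc] using
          transpose_mul_mul_mono hres (sigmaSqrt c η)
    _ ≤ Bᵀ * (margCov c X γ₀)⁻¹ * B :=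
        transpose_mul_mul_mono (one_sub_le_inv_one_add_mul_mul_transpose (posDef_sigmaMat hc γ₀)
          (isStarProjection_proj X γ₀) (proj_mul_cols hγ₀)) B
    _ ≤ 1 + Bᵀ * (margCov c X γ₀)⁻¹ * B := le_add_of_nonneg_left PosSemidef.one.nonneg
  rw [margCov_eq_add c X hs, mul_sigmaMat_mul_transpose hc', ← hB,
    det_add_mul _ _ ((isUnit_iff_isUnit_det _).1 hM.isUnit), ← Fintype.card_coe η]
  exact mul_le_mul_of_nonneg_left (pow_card_le_det (mul_nonneg hg ht.le) hquot) hM.det_pos.le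

end Determinant

section PenalizedRss

variable {n p : ℕ} {c : Fin p → ℝ}

theorem penalizedRss_nonneg (hc : ∀ j, 0 < c j) (X : Matrix (Fin n) (Fin p) ℝ)
    (y : Fin n → ℝ) (γ : Finset (Fin p)) : 0 ≤ penalizedRss c X y γ := by
  simpa [penalizedRss] using
    (posDef_margCov hc X γ).inv.posSemidef.dotProduct_mulVec_nonneg y

theorem penalizedRss_le {t : ℝ} (ht : 0 < t) (htc : ∀ j, t ≤ c j) (X : Matrix (Fin n) (Fin p) ℝ)
    (y : Fin n → ℝ) (γ : Finset (Fin p)) (b : γ → ℝ) :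
    penalizedRss c X y γ ≤ (y - cols X γ *ᵥ b) ⬝ᵥ (y - cols X γ *ᵥ b) + (b ⬝ᵥ b) / t := by
  refine (dotProduct_inv_one_add_mulVec_le
    (posDef_sigmaMat (fun j => ht.trans_le (htc j)) γ) (cols X γ) y b).trans ?_
  have := dotProduct_mulVec_mono (sigmaMat_inv_le ht htc γ) b
  rw [smul_mulVec, one_mulVec, dotProduct_smul, smul_eq_mul, ← div_eq_inv_mul] at this
  exact add_le_add le_rfl this

theorem le_penalizedRss (hc : ∀ j, 0 < c j) {X : Matrix (Fin n) (Fin p) ℝ} (y : Fin n → ℝ)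
    {γ : Finset (Fin p)} (h : Function.Injective (cols X γ).mulVec) :
    y ⬝ᵥ ((1 - proj X γ) *ᵥ y) ≤ penalizedRss c X y γ :=
  dotProduct_mulVec_mono (one_sub_le_inv_one_add_mul_mul_transpose (posDef_sigmaMat hc γ)
    (isStarProjection_proj X γ) (proj_mul_cols h)) y

theorem eq_zero_of_notMem_stateOf {β : Fin p → ℝ} {j : Fin p} (hj : j ∉ stateOf β) : β j = 0 := by
  simpa [stateOf] using hj

theorem dotProduct_restrict_self (γ : Finset (Fin p)) (b : Fin p → ℝ) :
    γ.restrict b ⬝ᵥ γ.restrict b = ∑ j ∈ γ, b j ^ 2 := by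
  simp only [sq]
  exact Finset.sum_coe_sort γ fun j => b j * b j

/-- The ridge criterion is evaluated at the least-squares estimator `β + (X_γᵀ X_γ)⁻¹ X_γᵀ e`. -/
theorem penalizedRss_stateOf_le {t g : ℝ} (ht : 0 < t) (htc : ∀ j, t ≤ c j) (hg : 0 < g)
    {X : Matrix (Fin n) (Fin p) ℝ} {β : Fin p → ℝ}
    (hgram : g • 1 ≤ (cols X (stateOf β))ᵀ * cols X (stateOf β)) (e : Fin n → ℝ) :
    penalizedRss c X (X *ᵥ β + e) (stateOf β) ≤ e ⬝ᵥ ((1 - proj X (stateOf β)) *ᵥ e) +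
      (2 * ∑ j ∈ stateOf β, β j ^ 2 + 2 * (e ⬝ᵥ e / g)) / t := by
  set γ := stateOf β
  set A := cols X γ with hA
  set z := (Aᵀ * A)⁻¹ *ᵥ (Aᵀ *ᵥ e) with hz
  have hAz : A *ᵥ z = proj X γ *ᵥ e := by rw [hz, proj, ← mulVec_mulVec, ← mulVec_mulVec]
  have hresid : X *ᵥ β + e - A *ᵥ (γ.restrict β + z) = (1 - proj X γ) *ᵥ e := by
    rw [mulVec_add, hAz, hA, cols_mulVec_restrict_of_support X fun _ => eq_zero_of_notMem_stateOf,
      sub_mulVec, one_mulVec, add_sub_add_left_eq_sub]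
  have hz_le : z ⬝ᵥ z ≤ e ⬝ᵥ e / g := by
    rw [le_div_iff₀' hg]
    calc g * (z ⬝ᵥ z) ≤ (A *ᵥ z) ⬝ᵥ (A *ᵥ z) := by
          simpa [smul_mulVec, dotProduct_transpose_mul_mulVec] using dotProduct_mulVec_mono hgram z
      _ ≤ e ⬝ᵥ e := by
          rw [hAz, dotProduct_mulVec_self_of_isStarProjection (isStarProjection_proj X γ)]
          exact dotProduct_mulVec_le_of_isStarProjection (isStarProjection_proj X γ) e
  have hb : (γ.restrict β + z) ⬝ᵥ (γ.restrict β + z) ≤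
      2 * ∑ j ∈ γ, β j ^ 2 + 2 * (e ⬝ᵥ e / g) := by
    rw [← dotProduct_restrict_self]
    exact (dotProduct_self_add_le _ _).trans (by gcongr)
  have hle := penalizedRss_le ht htc X (X *ᵥ β + e) γ (γ.restrict β + z)
  rw [← hA, hresid,
    dotProduct_mulVec_self_of_isStarProjection (isStarProjection_proj X γ).one_sub] at hle
  exact hle.trans (by gcongr)

theorem le_penalizedRss_of_subset (hc : ∀ j, 0 < c j) {X : Matrix (Fin n) (Fin p) ℝ}
    {β : Fin p → ℝ} {γ : Finset (Fin p)} (hs : stateOf β ⊆ γ)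
    (hγ : Function.Injective (cols X γ).mulVec) (e : Fin n → ℝ) :
    e ⬝ᵥ ((1 - proj X γ) *ᵥ e) ≤ penalizedRss c X (X *ᵥ β + e) γ := by
  have hsignal : (1 - proj X γ) *ᵥ (X *ᵥ β) = 0 := by
    rw [sub_mulVec, one_mulVec, proj_mulVec_mulVec hγ fun j hj =>
      eq_zero_of_notMem_stateOf fun h => hj (hs h), sub_self]
  rw [← dotProduct_mulVec_add_of_mulVec_eq_zero (isStarProjection_proj X γ).one_sub hsignal]
  exact le_penalizedRss hc _ hγ

theorem sq_mul_le_dotProduct_one_sub_proj {X : Matrix (Fin n) (Fin p) ℝ} {β : Fin p → ℝ}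
    {γ : Finset (Fin p)} (hγ : Function.Injective (cols X γ).mulVec) (hs : ¬ stateOf β ⊆ γ)
    {g m : ℝ} (hg : 0 ≤ g) (hm : 0 ≤ m) (hβ : ∀ j ∈ stateOf β, m ≤ |β j|)
    (hres : g • 1 ≤ (cols X (stateOf β \ γ))ᵀ * (1 - proj X γ) * cols X (stateOf β \ γ)) :
    g * m ^ 2 ≤ (X *ᵥ β) ⬝ᵥ ((1 - proj X γ) *ᵥ (X *ᵥ β)) := by
  obtain ⟨j, hj, hjγ⟩ := Finset.not_subset.1 hs
  set b := (stateOf β \ γ).restrict β with hb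
  have hb_ge : m ^ 2 ≤ b ⬝ᵥ b := by
    rw [hb, dotProduct_restrict_self]
    exact (sq_le_sq.2 ((abs_of_nonneg hm).trans_le (hβ j hj))).trans
      (Finset.single_le_sum (fun i _ => sq_nonneg (β i)) (Finset.mem_sdiff.2 ⟨hj, hjγ⟩))
  have hD := (isStarProjection_proj X γ).one_sub
  calc g * m ^ 2 ≤ g * (b ⬝ᵥ b) := by gcongr
    _ ≤ (cols X (stateOf β \ γ) *ᵥ b) ⬝ᵥ ((1 - proj X γ) *ᵥ (cols X (stateOf β \ γ) *ᵥ b)) := by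
        rw [← dotProduct_transpose_mul_mul_mulVec]
        simpa [smul_mulVec] using dotProduct_mulVec_mono hres b
    _ = (X *ᵥ β) ⬝ᵥ ((1 - proj X γ) *ᵥ (X *ᵥ β)) := by
        rw [← dotProduct_mulVec_self_of_isStarProjection hD, hb, ← one_sub_proj_mulVec_mulVec hγ
          fun _ => eq_zero_of_notMem_stateOf, dotProduct_mulVec_self_of_isStarProjection hD]

theorem le_penalizedRss_of_not_subset (hc : ∀ j, 0 < c j) {X : Matrix (Fin n) (Fin p) ℝ}
    (hX : Function.Injective X.mulVec) {β : Fin p → ℝ} {γ : Finset (Fin p)}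
    (hs : ¬ stateOf β ⊆ γ) {g m : ℝ} (hg : 0 ≤ g) (hm : 0 ≤ m)
    (hβ : ∀ j ∈ stateOf β, m ≤ |β j|)
    (hres : g • 1 ≤ (cols X (stateOf β \ γ))ᵀ * (1 - proj X γ) * cols X (stateOf β \ γ))
    (e : Fin n → ℝ) :
    e ⬝ᵥ e + g * m ^ 2 / 2 - 2 * (e ⬝ᵥ (proj X Finset.univ *ᵥ e)) ≤
      penalizedRss c X (X *ᵥ β + e) γ := by
  have hγ := mulVec_injective_cols hX γ
  have huniv := mulVec_injective_cols hX Finset.univ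
  have hsignal := sq_mul_le_dotProduct_one_sub_proj hγ hs hg hm hβ hres
  have hsplit := dotProduct_one_sub_mulVec_add_ge (isStarProjection_proj X γ)
    (isStarProjection_proj X Finset.univ)
    (proj_mul_proj_of_subset huniv (Finset.subset_univ γ))
    (proj_mulVec_mulVec huniv fun j hj => absurd (Finset.mem_univ j) hj) e (x := X *ᵥ β)
  linarith [le_penalizedRss hc (X *ᵥ β + e) hγ]

end PenalizedRss

section Gaussian

theorem integral_exp_mul_sq_gaussianReal {t : ℝ} (ht : t < 1 / 2) :
    ∫ x, Real.exp (t * x ^ 2) ∂gaussianReal 0 1 = (1 - 2 * t) ^ (-(1 / 2) : ℝ) := by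
  have hdensity (x : ℝ) : gaussianPDFReal 0 1 x • Real.exp (t * x ^ 2) =
      (√(2 * Real.pi))⁻¹ * Real.exp (-((1 - 2 * t) / 2) * x ^ 2) := by
    rw [gaussianPDFReal, smul_eq_mul, mul_assoc, ← Real.exp_add, NNReal.coe_one, mul_one]
    ring_nf
  have := Real.pi_pos
  have ht' : 0 < 1 - 2 * t := by linarith
  simp_rw [integral_gaussianReal_eq_integral_smul one_ne_zero, hdensity]
  rw [integral_const_mul, integral_gaussian, Real.rpow_neg ht'.le, ← Real.sqrt_eq_rpow,
    ← Real.sqrt_inv, ← Real.sqrt_inv, ← Real.sqrt_mul (by positivity)]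
  congr 1
  field_simp

variable {m : Type*} [Fintype m]

theorem pi_gaussianReal_sq (σ : ℝ≥0) :
    Measure.pi (fun _ : m => gaussianReal 0 (σ ^ 2)) =
      (Measure.pi fun _ : m => gaussianReal 0 1).map fun x => (σ : ℝ) • x := by
  have hmap : gaussianReal 0 (σ ^ 2) = (gaussianReal 0 1).map ((σ : ℝ) * ·) := by
    rw [gaussianReal_map_const_mul, mul_zero, mul_one]
    rfl
  have : SigmaFinite ((gaussianReal 0 1).map ((σ : ℝ) * ·)) := hmap ▸ inferInstance
  simp_rw [hmap]
  exact (Measure.pi_map_pi fun _ => (measurable_const_mul _).aemeasurable).symm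

variable [DecidableEq m]

theorem dotProduct_mulVec_sum_eigenvectorBasis {A : Matrix m m ℝ} (hA : A.IsHermitian)
    (z : m → ℝ) :
    (∑ i, z i • hA.eigenvectorBasis i).ofLp ⬝ᵥ (A *ᵥ (∑ i, z i • hA.eigenvectorBasis i).ofLp) =
      ∑ i, hA.eigenvalues i * z i ^ 2 := by
  have horth := hA.eigenvectorBasis.orthonormal
  have hA_mul : A *ᵥ (∑ i, z i • hA.eigenvectorBasis i).ofLp =
      (∑ i, (z i * hA.eigenvalues i) • hA.eigenvectorBasis i).ofLp := by
    simp only [WithLp.ofLp_sum, WithLp.ofLp_smul, mulVec_sum, mulVec_smul,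
      hA.mulVec_eigenvectorBasis, mul_smul]
  rw [hA_mul]
  refine (horth.inner_sum (fun i => z i * hA.eigenvalues i) z Finset.univ).trans
    (Finset.sum_congr rfl fun i _ => ?_)
  rw [conj_trivial]
  ring

theorem integral_exp_dotProduct_mulVec_pi_gaussianReal {A : Matrix m m ℝ} (hA : A.IsHermitian)
    {t : ℝ} (ht : ∀ i, t * hA.eigenvalues i < 1 / 2) :
    ∫ x, Real.exp (t * (x ⬝ᵥ (A *ᵥ x))) ∂Measure.pi (fun _ : m => gaussianReal 0 1) =
      ∏ i, (1 - 2 * (t * hA.eigenvalues i)) ^ (-(1 / 2) : ℝ) := by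
  set γ := Measure.pi fun _ : m => gaussianReal 0 1
  set b := hA.eigenvectorBasis
  have hrot : γ.map (WithLp.toLp 2) = γ.map fun z => ∑ i, z i • b i := by
    rw [map_pi_eq_stdGaussian, stdGaussian_eq_map_pi_orthonormalBasis b]
  have hF : Continuous fun x : EuclideanSpace ℝ m =>
      Real.exp (t * (x.ofLp ⬝ᵥ (A *ᵥ x.ofLp))) := by fun_prop
  have hsum : Measurable fun z : m → ℝ => ∑ i, z i • b i := by fun_prop
  calc ∫ x, Real.exp (t * (x ⬝ᵥ (A *ᵥ x))) ∂γ
      = ∫ x, Real.exp (t * (x.ofLp ⬝ᵥ (A *ᵥ x.ofLp))) ∂γ.map (WithLp.toLp 2) := by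
        rw [integral_map (by fun_prop) hF.aestronglyMeasurable]
    _ = ∫ z, Real.exp (t * ∑ i, hA.eigenvalues i * z i ^ 2) ∂γ := by
        rw [hrot, integral_map hsum.aemeasurable hF.aestronglyMeasurable]
        simp_rw [b, dotProduct_mulVec_sum_eigenvectorBasis hA]
    _ = ∏ i, ∫ x, Real.exp (t * hA.eigenvalues i * x ^ 2) ∂gaussianReal 0 1 := by
        simp_rw [Finset.mul_sum, ← mul_assoc, Real.exp_sum]
        exact integral_fintype_prod_eq_prod fun i x => Real.exp (t * hA.eigenvalues i * x ^ 2)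
    _ = ∏ i, (1 - 2 * (t * hA.eigenvalues i)) ^ (-(1 / 2) : ℝ) :=
        Finset.prod_congr rfl fun i _ => integral_exp_mul_sq_gaussianReal (ht i)

theorem eigenvalues_eq_zero_or_one {D : Matrix m m ℝ} (hD : IsStarProjection D)
    (hH : D.IsHermitian) (i : m) : hH.eigenvalues i = 0 ∨ hH.eigenvalues i = 1 :=
  hD.isIdempotentElem.spectrum_subset ℝ (hH.eigenvalues_mem_spectrum_real i)

omit [DecidableEq m] in
theorem integral_exp_dotProduct_mulVec_of_isStarProjection {D : Matrix m m ℝ}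
    (hD : IsStarProjection D) {t : ℝ} (ht : t < 1 / 2) :
    ∫ x, Real.exp (t * (x ⬝ᵥ (D *ᵥ x))) ∂Measure.pi (fun _ : m => gaussianReal 0 1) =
      (1 - 2 * t) ^ (-(D.trace / 2)) := by
  classical
  have hH : D.IsHermitian := hD.isSelfAdjoint
  have htrace : -(D.trace / 2) = ∑ i, -(hH.eigenvalues i / 2) := by
    rw [hH.trace_eq_sum_eigenvalues, Finset.sum_div, Finset.sum_neg_distrib]
    rfl
  rw [integral_exp_dotProduct_mulVec_pi_gaussianReal hH fun i => ?_, htrace,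
    Real.rpow_sum_of_pos (by linarith)]
  · refine Finset.prod_congr rfl fun i _ => ?_
    rcases eigenvalues_eq_zero_or_one hD hH i with h | h <;> simp [h]
  · rcases eigenvalues_eq_zero_or_one hD hH i with h | h <;> rw [h] <;> linarith

omit [DecidableEq m] in
/-- Both signs of `t` are allowed: a positive `t` bounds the upper tail of the chi-square variable
`xᵀ D x / σ²`, a negative one the lower tail. -/
theorem measure_pi_gaussianReal_le_exp_mul_rpow {σ : ℝ≥0} (hσ : 0 < σ) {D : Matrix m m ℝ}
    (hD : IsStarProjection D) {t : ℝ} (ht : t < 1 / 2) (r : ℝ) :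
    Measure.pi (fun _ : m => gaussianReal 0 (σ ^ 2))
        {x | r ≤ t * (x ⬝ᵥ (D *ᵥ x) / (σ : ℝ) ^ 2)} ≤
      ENNReal.ofReal (Real.exp (-r) * (1 - 2 * t) ^ (-(D.trace / 2))) := by
  have hmgf := integral_exp_dotProduct_mulVec_of_isStarProjection hD ht
  have hint : Integrable (fun x => Real.exp (t * (x ⬝ᵥ (D *ᵥ x))))
      (Measure.pi fun _ : m => gaussianReal 0 1) :=
    not_imp_comm.1 integral_undef (hmgf ▸ (Real.rpow_pos_of_pos (by linarith) _).ne')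
  have hchernoff := measure_ge_le_exp_mul_mgf (X := fun x => t * (x ⬝ᵥ (D *ᵥ x))) r zero_le_one
    (by simpa using hint)
  have : (σ : ℝ) ^ 2 ≠ 0 := by positivity
  rw [pi_gaussianReal_sq, Measure.map_apply (by fun_prop)
    (measurableSet_le (by fun_prop) (by fun_prop)), ← ofReal_measureReal]
  refine ENNReal.ofReal_le_ofReal (le_trans (le_of_eq ?_) (hchernoff.trans_eq ?_))
  · simp only [Set.preimage_ofPred_eq, mulVec_smul, smul_dotProduct, dotProduct_smul, smul_eq_mul,
      ← mul_assoc, ← sq]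
    field_simp
  · rw [mgf, neg_one_mul]
    simp only [one_mul, hmgf]

end Gaussian

section Measurability

variable {α m k : Type*} [MeasurableSpace α]

theorem measurable_comp_matrix [Countable m] [Countable k] {f : Matrix m k ℝ → ℝ}
    (hf : Continuous f) {A : α → Matrix m k ℝ} (hA : ∀ i j, Measurable fun a => A a i j) :
    Measurable fun a => f (A a) :=
  (show Continuous fun B : m → k → ℝ => f (of B) from hf).measurable.comp
    (measurable_pi_lambda _ fun i => measurable_pi_lambda _ fun j => hA i j)

theorem measurableSet_mulVec_injective [Finite m] [Fintype k] {A : α → Matrix m k ℝ}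
    (hA : ∀ i j, Measurable fun a => A a i j) :
    MeasurableSet {a | Function.Injective (A a).mulVec} := by
  classical
  cases nonempty_fintype m
  simp only [mulVec_injective_iff_isUnit_det_gram, isUnit_iff_ne_zero]
  exact (measurable_comp_matrix (f := fun B => (Bᵀ * B).det)
    (continuous_id.matrix_transpose.matrix_mul continuous_id).matrix_det hA)
    (measurableSet_singleton 0).compl

theorem measurableSet_matrix_le [Finite m] {A B : α → Matrix m m ℝ}
    (hA : ∀ i j, Measurable fun a => A a i j) (hB : ∀ i j, Measurable fun a => B a i j) :
    MeasurableSet {a | A a ≤ B a} := by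
  cases nonempty_fintype m
  have hclosed : IsClosed {D : m → m → ℝ | (of D).PosSemidef} := by
    simp only [posSemidef_iff_dotProduct_mulVec, Set.ofPred_and, Set.ofPred_forall]
    have hof : Continuous (of : (m → m → ℝ) → Matrix m m ℝ) := continuous_id
    exact (isClosed_eq hof.matrix_conjTranspose hof).inter <| isClosed_iInter fun v =>
      isClosed_le continuous_const
        (continuous_const.dotProduct (hof.matrix_mulVec continuous_const))
  have hsub : Measurable fun a i j => (B a - A a) i j :=
    measurable_pi_lambda _ fun i => measurable_pi_lambda _ fun j => (hB i j).sub (hA i j)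
  simp only [le_iff]
  exact hsub hclosed.measurableSet

variable {n p : ℕ}

theorem measurable_proj {X : α → Matrix (Fin n) (Fin p) ℝ} (hX : ∀ i j, Measurable fun a => X a i j)
    (γ : Finset (Fin p)) (i k : Fin n) : Measurable fun a => proj (X a) γ i k := by
  have hcols : Continuous fun B : Matrix (Fin n) (Fin p) ℝ => cols B γ :=
    continuous_id.matrix_submatrix _ _
  have hgram := hcols.matrix_transpose.matrix_mul hcols
  simp only [proj, inv_def, Ring.inverse_eq_inv', Matrix.mul_smul, Matrix.smul_mul,
    Matrix.smul_apply, smul_eq_mul]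
  exact (measurable_comp_matrix hgram.matrix_det hX).inv.mul (measurable_comp_matrix
    (((hcols.matrix_mul hgram.matrix_adjugate).matrix_mul hcols.matrix_transpose).matrix_elem i k)
    hX)

theorem measurable_transpose_mul_one_sub_proj_mul {X : α → Matrix (Fin n) (Fin p) ℝ}
    (hX : ∀ i j, Measurable fun a => X a i j) (η γ : Finset (Fin p)) (i j : η) :
    Measurable fun a =>
      ((cols (X a) η)ᵀ * (1 - proj (X a) γ) * cols (X a) η : Matrix η η ℝ) i j := by
  simp only [mul_apply, transpose_apply, Matrix.sub_apply, cols, submatrix_apply, id]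
  have hproj := measurable_proj hX γ
  fun_prop

end Measurability

section Chernoff

variable {Ω α β : Type*} [MeasurableSpace Ω] [MeasurableSpace α] [MeasurableSpace β]
  {μ : Measure Ω}

theorem measure_le_of_indepFun [IsProbabilityMeasure μ] {Z : Ω → α} {ε : Ω → β} {N : Measure β}
    (hZ : Measurable Z) (hε : HasLaw ε N μ) (hindep : IndepFun Z ε μ) {S : Set (α × β)}
    (hS : MeasurableSet S) {b : ENNReal} (hb : ∀ z, N {e | (z, e) ∈ S} ≤ b) :
    μ {ω | (Z ω, ε ω) ∈ S} ≤ b := by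
  have hprod := (indepFun_iff_map_prod_eq_prod_map_map hZ.aemeasurable hε.aemeasurable).1 hindep
  have := hε.isProbabilityMeasure_iff.1 ‹_›
  have := Measure.isProbabilityMeasure_map hZ.aemeasurable (μ := μ)
  calc μ {ω | (Z ω, ε ω) ∈ S} = (μ.map fun ω => (Z ω, ε ω)) S :=
        (Measure.map_apply_of_aemeasurable (hZ.aemeasurable.prodMk hε.aemeasurable) hS).symm
    _ = ∫⁻ z, N {e | (z, e) ∈ S} ∂(μ.map Z) := by
        rw [hprod, hε.map_eq, Measure.prod_apply hS]
        rfl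
    _ ≤ ∫⁻ _, b ∂(μ.map Z) := lintegral_mono hb
    _ = b := by simp

variable {n p : ℕ} {σ : ℝ≥0} {X : Ω → Matrix (Fin n) (Fin p) ℝ} {ε : Ω → Fin n → ℝ}

theorem measure_dotProduct_self_ge_le (hσ : 0 < σ)
    (hε : HasLaw ε (Measure.pi fun _ : Fin n => gaussianReal 0 (σ ^ 2)) μ) {t : ℝ} (ht : t < 1 / 2)
    (r : ℝ) : μ {ω | r ≤ t * (ε ω ⬝ᵥ ε ω / (σ : ℝ) ^ 2)} ≤
      ENNReal.ofReal (Real.exp (-r) * (1 - 2 * t) ^ (-((n : ℝ) / 2))) := by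
  rw [hε.measure_eq (p := fun e => r ≤ t * (e ⬝ᵥ e / (σ : ℝ) ^ 2))
    (measurableSet_le (by fun_prop) (by fun_prop))]
  simpa using measure_pi_gaussianReal_le_exp_mul_rpow (m := Fin n) hσ (.one _) ht r

theorem measure_dotProduct_proj_sub_proj_ge_le [IsProbabilityMeasure μ] (hσ : 0 < σ)
    (hX : ∀ i j, Measurable fun ω => X ω i j)
    (hε : HasLaw ε (Measure.pi fun _ : Fin n => gaussianReal 0 (σ ^ 2)) μ)
    (hindep : IndepFun (fun ω i j => X ω i j) ε μ) {γ γ' : Finset (Fin p)} (hs : γ ⊆ γ') {t : ℝ}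
    (ht : t < 1 / 2) (r : ℝ) :
    μ {ω | Function.Injective (X ω).mulVec ∧
        r ≤ t * (ε ω ⬝ᵥ ((proj (X ω) γ' - proj (X ω) γ) *ᵥ ε ω) / (σ : ℝ) ^ 2)} ≤
      ENNReal.ofReal (Real.exp (-r) * (1 - 2 * t) ^ (-((γ' \ γ).card / 2 : ℝ))) := by
  have hfst : ∀ i j, Measurable fun z : (Fin n → Fin p → ℝ) × (Fin n → ℝ) => of z.1 i j :=
    fun i j => by simp only [of_apply]; fun_prop
  refine measure_le_of_indepFun (Z := fun ω i j => X ω i j)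
    (S := {z | Function.Injective (of z.1).mulVec ∧
      r ≤ t * (z.2 ⬝ᵥ ((proj (of z.1) γ' - proj (of z.1) γ) *ᵥ z.2) / (σ : ℝ) ^ 2)})
    (by fun_prop) hε hindep ?_ fun A => ?_
  · have hγ := measurable_proj hfst γ
    have hγ' := measurable_proj hfst γ'
    rw [Set.ofPred_and]
    refine (measurableSet_mulVec_injective hfst).inter (measurableSet_le measurable_const ?_)
    simp only [dotProduct, mulVec, Matrix.sub_apply]
    fun_prop
  · by_cases hA : Function.Injective (of A).mulVec
    · have hγ := mulVec_injective_cols hA γ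
      have hγ' := mulVec_injective_cols hA γ'
      have hD : IsStarProjection (proj (of A) γ' - proj (of A) γ) :=
        (isStarProjection_proj _ γ).sub_of_mul_eq_right (isStarProjection_proj _ γ')
          (proj_mul_proj_of_subset hγ' hs)
      have htrace : (proj (of A) γ' - proj (of A) γ).trace = (γ' \ γ).card := by
        rw [trace_sub, trace_proj hγ', trace_proj hγ, Finset.cast_card_sdiff hs]
      simpa [hA, htrace] using measure_pi_gaussianReal_le_exp_mul_rpow hσ hD ht r
    · simp [hA]

end Chernoff

section RegularDesign

variable {n p : ℕ} {γ₀ : Finset (Fin p)} {X : Matrix (Fin n) (Fin p) ℝ} {g G h : ℝ}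

/-- A design for which the eigenvalue conditions on `φ_min`, `φ_max` and on the models in `S₁ γ₀`
hold with the constants `g`, `G` and `h`. They are expressed in the Loewner order and without the
normalization `1 / n`; of the condition on `φ_max` only the instance `γ = ∅` is kept. -/
structure RegularDesign (γ₀ : Finset (Fin p)) (g G h : ℝ) (X : Matrix (Fin n) (Fin p) ℝ) :
    Prop where
  gram_le : (cols X γ₀)ᵀ * cols X γ₀ ≤ G • (1 : Matrix γ₀ γ₀ ℝ)
  le_of_mem_S₂ : ∀ γ ∈ S₂ γ₀,
    g • (1 : Matrix (γ₀ \ γ : Finset (Fin p)) (γ₀ \ γ : Finset (Fin p)) ℝ) ≤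
      (cols X (γ₀ \ γ))ᵀ * (1 - proj X γ) * cols X (γ₀ \ γ)
  le_of_mem_S₁ : ∀ γ ∈ S₁ γ₀,
    h • (1 : Matrix (γ \ γ₀ : Finset (Fin p)) (γ \ γ₀ : Finset (Fin p)) ℝ) ≤
      (cols X (γ \ γ₀))ᵀ * (1 - proj X γ₀) * cols X (γ \ γ₀)

theorem proj_empty (X : Matrix (Fin n) (Fin p) ℝ) : proj X ∅ = 0 := by
  ext i k
  simp [proj, mul_apply]

theorem empty_mem_S₂ (h₀ : γ₀.Nonempty) : ∅ ∈ S₂ γ₀ := fun h =>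
  h₀.ne_empty (Finset.subset_empty.1 h)

theorem RegularDesign.le_gram (hX : RegularDesign γ₀ g G h X) (h₀ : γ₀.Nonempty) :
    g • (1 : Matrix γ₀ γ₀ ℝ) ≤ (cols X γ₀)ᵀ * cols X γ₀ := by
  have := hX.le_of_mem_S₂ ∅ (empty_mem_S₂ h₀)
  rwa [proj_empty, sub_zero, Matrix.mul_one, Finset.sdiff_empty] at this

theorem RegularDesign.mulVec_injective (hX : RegularDesign γ₀ g G h X) (h₀ : γ₀.Nonempty)
    (hg : 0 < g) (hh : 0 < h) : Function.Injective X.mulVec := by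
  have hγ₀ : Function.Injective (cols X γ₀).mulVec := mulVec_injective_iff_isUnit_det_gram.2
    ((isUnit_iff_isUnit_det _).1 (posDef_of_smul_one_le hg (hX.le_gram h₀)).isUnit)
  refine mulVec_injective_of_posDef hγ₀ ?_
  by_cases huniv : Finset.univ = γ₀
  · have : IsEmpty (Finset.univ \ γ₀ : Finset (Fin p)) :=
      Finset.isEmpty_coe_sort.2 (by rw [huniv, sdiff_self, Finset.bot_eq_empty])
    exact ⟨Subsingleton.elim _ _, fun v hv => absurd (Subsingleton.elim v 0) hv⟩
  · exact posDef_of_smul_one_le hh (hX.le_of_mem_S₁ _ ⟨Finset.subset_univ _, huniv⟩)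

theorem isHermitian_residGram (X : Matrix (Fin n) (Fin p) ℝ) (η γ : Finset (Fin p)) :
    (residGram X η γ).IsHermitian := by
  rw [IsHermitian, conjTranspose_eq_transpose_of_trivial, residGram, transpose_smul,
    transpose_mul, transpose_mul, transpose_transpose, transpose_sub, transpose_one,
    proj_transpose, Matrix.mul_assoc]

theorem smul_residGram (hn : 1 ≤ n) (X : Matrix (Fin n) (Fin p) ℝ) (η γ : Finset (Fin p)) :
    (n : ℝ) • residGram X η γ = (cols X η)ᵀ * (1 - proj X γ) * cols X η := by
  rw [residGram, smul_smul, mul_one_div_cancel (by positivity), one_smul]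

theorem mul_smul_one_le_of_le_eigMin_residGram (hn : 1 ≤ n) {η γ : Finset (Fin p)} {c : ℝ}
    (hc : c ≤ eigMin (residGram X η γ)) :
    (n * c) • (1 : Matrix η η ℝ) ≤ (cols X η)ᵀ * (1 - proj X γ) * cols X η := by
  rw [mul_smul, ← smul_residGram hn]
  exact smul_le_smul_of_nonneg_left (smul_one_le_of_le_eigMin (isHermitian_residGram X η γ) hc)
    n.cast_nonneg

theorem gram_le_mul_smul_one_of_phiMax_le (hn : 1 ≤ n) (h₀ : γ₀.Nonempty) {C : ℝ}
    (hC : phiMax γ₀ X ≤ C) :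
    (cols X γ₀)ᵀ * cols X γ₀ ≤ (n * C) • (1 : Matrix γ₀ γ₀ ℝ) := by
  have heig : eigMax (residGram X γ₀ ∅) ≤ C := by
    have := (le_ciSup (Set.finite_range _).bddAbove ⟨∅, empty_mem_S₂ h₀⟩).trans hC
    rwa [Finset.sdiff_empty, ← Matrix.mul_one (cols X γ₀)ᵀ, ← sub_zero (1 : Matrix _ _ ℝ),
      ← proj_empty X] at this
  have hle := le_smul_one_of_eigMax_le (isHermitian_residGram X γ₀ ∅) heig
  have hsmul := smul_le_smul_of_nonneg_left hle n.cast_nonneg (α := ℝ)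
  rwa [smul_residGram hn, proj_empty, sub_zero, Matrix.mul_one, ← mul_smul] at hsmul

theorem regularDesign_of_eig (hn : 1 ≤ n) (h₀ : γ₀.Nonempty) (hg : g ≤ phiMin γ₀ X)
    (hG : phiMax γ₀ X ≤ G) (hh : ∀ γ ∈ S₁ γ₀, h ≤ eigMin (residGram X (γ \ γ₀) γ₀)) :
    RegularDesign γ₀ (n * g) (n * G) (n * h) X where
  gram_le := gram_le_mul_smul_one_of_phiMax_le hn h₀ hG
  le_of_mem_S₂ γ hγ := mul_smul_one_le_of_le_eigMin_residGram hn
    (hg.trans (ciInf_le (Set.finite_range fun γ : S₂ γ₀ =>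
      eigMin (residGram X (γ₀ \ (γ : Finset (Fin p))) γ)).bddBelow ⟨γ, hγ⟩))
  le_of_mem_S₁ γ hγ := mul_smul_one_le_of_le_eigMin_residGram hn (hh γ hγ)

theorem measurableSet_regularDesign {α : Type*} [MeasurableSpace α]
    {X : α → Matrix (Fin n) (Fin p) ℝ} (hX : ∀ i j, Measurable fun a => X a i j)
    (γ₀ : Finset (Fin p)) (g G h : ℝ) : MeasurableSet {a | RegularDesign γ₀ g G h (X a)} := by
  have hgram : ∀ i j, Measurable fun a => ((cols (X a) γ₀)ᵀ * cols (X a) γ₀) i j := fun i j =>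
    measurable_comp_matrix (f := fun B => ((cols B γ₀)ᵀ * cols B γ₀) i j) (by
      have hcols : Continuous fun B : Matrix (Fin n) (Fin p) ℝ => cols B γ₀ :=
        continuous_id.matrix_submatrix _ _
      exact (hcols.matrix_transpose.matrix_mul hcols).matrix_elem i j) hX
  have hresid := fun (η γ : Finset (Fin p)) (c : ℝ) => measurableSet_matrix_le
    (A := fun _ => c • 1) (fun _ _ => measurable_const)
    (measurable_transpose_mul_one_sub_proj_mul hX η γ)
  have hS₂ := MeasurableSet.iInter fun γ => .iInter fun _ : γ ∈ S₂ γ₀ => hresid (γ₀ \ γ) γ g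
  have hS₁ := MeasurableSet.iInter fun γ => .iInter fun _ : γ ∈ S₁ γ₀ => hresid (γ \ γ₀) γ₀ h
  convert (measurableSet_matrix_le hgram (B := fun _ => G • 1) fun _ _ => measurable_const).inter
    (hS₂.inter hS₁) using 1
  ext a
  simp only [Set.mem_inter_iff, Set.mem_iInter]
  exact ⟨fun ⟨hG, hg, hh⟩ => ⟨hG, hg, hh⟩, fun ⟨hG, hg, hh⟩ => ⟨hG, hg, hh⟩⟩

end RegularDesign

section RegularDesignLimit

variable {Ω : Type*} [MeasurableSpace Ω] {μ : Measure Ω}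

theorem tendsto_measure_not_of_ae_eventually [IsFiniteMeasure μ] {R : ℕ → Ω → Prop}
    (hR : ∀ n, MeasurableSet {ω | R n ω}) (h : ∀ᵐ ω ∂μ, ∀ᶠ n in atTop, R n ω) :
    Tendsto (fun n => μ {ω | ¬ R n ω}) atTop (𝓝 0) := by
  have := tendsto_measure_of_ae_tendsto_indicator_of_isFiniteMeasure (μ := μ) atTop
    MeasurableSet.empty (fun n => (hR n).compl) <| by
      filter_upwards [h] with ω hω
      filter_upwards [hω] with n hn
      simp [hn]
  simpa [Set.compl_ofPred] using this

variable {p : ℕ → ℕ} {γ₀ : ∀ n, Finset (Fin (p n))}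
  {X : ∀ n, Ω → Matrix (Fin n) (Fin (p n)) ℝ} {g G C₁ C₂ : ℝ} {h : ℕ → ℝ}

theorem ae_eventually_regularDesign (h₀ : ∀ n, 1 ≤ n → (γ₀ n).Nonempty)
    (hg : g < C₁) (hG : C₂ < G)
    (hmin : ∀ᵐ ω ∂μ,
      (C₁ : EReal) ≤ liminf (fun n => ((phiMin (γ₀ n) (X n ω) : ℝ) : EReal)) atTop)
    (hmax : ∀ᵐ ω ∂μ,
      limsup (fun n => ((phiMax (γ₀ n) (X n ω) : ℝ) : EReal)) atTop ≤ (C₂ : EReal))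
    (hS₁ : ∀ n, 1 ≤ n → ∀ᵐ ω ∂μ, ∀ γ ∈ S₁ (γ₀ n),
      h n ≤ eigMin (residGram (X n ω) (γ \ γ₀ n) (γ₀ n))) :
    ∀ᵐ ω ∂μ, ∀ᶠ n in atTop, RegularDesign (γ₀ n) (n * g) (n * G) (n * h n) (X n ω) := by
  filter_upwards [hmin, hmax, ae_all_iff.2 fun n => ae_all_iff.2 (hS₁ n)] with ω hω₁ hω₂ hω₃
  filter_upwards [eventually_lt_of_lt_liminf ((EReal.coe_lt_coe_iff.2 hg).trans_le hω₁),
    eventually_lt_of_limsup_lt (hω₂.trans_lt (EReal.coe_lt_coe_iff.2 hG)),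
    eventually_ge_atTop 1] with n hn₁ hn₂ hn
  exact regularDesign_of_eig hn (h₀ n hn) (EReal.coe_lt_coe_iff.1 hn₁).le
    (EReal.coe_lt_coe_iff.1 hn₂).le (hω₃ n hn)

end RegularDesignLimit

section TypicalNoise

variable {n p : ℕ}

theorem mem_S₁_iff_ssubset {γ₀ γ : Finset (Fin p)} : γ ∈ S₁ γ₀ ↔ γ₀ ⊂ γ :=
  (and_congr_right fun _ => ne_comm).trans Finset.ssubset_iff_subset_ne.symm

theorem sum_pow_card_sdiff_le {x : ℝ} (hx : 0 ≤ x) (γ₀ : Finset (Fin p)) :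
    ∑ γ with γ₀ ⊂ γ, x ^ (γ \ γ₀).card ≤ (1 + x) ^ p - 1 := by
  have hsum : ∑ s ∈ Finset.univ.erase (∅ : Finset (Fin p)), x ^ s.card = (1 + x) ^ p - 1 := by
    rw [Finset.sum_erase_eq_sub (Finset.mem_univ _), Finset.card_empty, pow_zero]
    simpa [add_comm] using Finset.sum_pow_mul_eq_add_pow x 1 (Finset.univ : Finset (Fin p))
  rw [← hsum, ← Finset.sum_image (f := fun s : Finset (Fin p) => x ^ s.card) (g := (· \ γ₀))]
  · refine Finset.sum_le_sum_of_subset_of_nonneg (Finset.image_subset_iff.2 fun γ hγ => ?_)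
      fun s _ _ => pow_nonneg hx _
    have hss := (Finset.mem_filter.1 hγ).2
    exact Finset.mem_erase.2
      ⟨(Finset.sdiff_nonempty.2 hss.not_subset).ne_empty, Finset.mem_univ _⟩
  · intro γ hγ γ' hγ' h
    rw [← Finset.sdiff_union_of_subset (Finset.mem_filter.1 hγ).2.subset,
      ← Finset.sdiff_union_of_subset (Finset.mem_filter.1 hγ').2.subset]
    exact congrArg (· ∪ γ₀) h

/-- The event on which the Gaussian errors `e` behave as expected: with `v` their variance, `‖e‖²`
is of order `v * n`, its part `eᵀ P e` explained by all the columns of `X` is negligible, and every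
superfluous column of an overfitted model explains at most `2 * v * (1 + a) * log n`. -/
structure TypicalNoise (γ₀ : Finset (Fin p)) (v a b : ℝ) (X : Matrix (Fin n) (Fin p) ℝ)
    (e : Fin n → ℝ) : Prop where
  le_dotProduct_self : (1 - a / 2) * v * n ≤ e ⬝ᵥ e
  dotProduct_self_le : e ⬝ᵥ e ≤ 2 * v * n
  dotProduct_proj_univ_le : e ⬝ᵥ (proj X Finset.univ *ᵥ e) ≤ b * n
  gain_le : ∀ γ ∈ S₁ γ₀, e ⬝ᵥ ((proj X γ - proj X γ₀) *ᵥ e) ≤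
    (γ \ γ₀).card * (2 * v * (1 + a) * Real.log n)

variable {Ω : Type*} [MeasurableSpace Ω] {μ : Measure Ω} {σ : ℝ≥0} {ε : Ω → Fin n → ℝ}

theorem measure_dotProduct_self_gt_le (hσ : 0 < σ)
    (hε : HasLaw ε (Measure.pi fun _ : Fin n => gaussianReal 0 (σ ^ 2)) μ) :
    μ {ω | 2 * (σ : ℝ) ^ 2 * n < ε ω ⬝ᵥ ε ω} ≤
      ENNReal.ofReal (Real.exp (-((1 - Real.log 2) / 2 * n))) := by
  have : (0 : ℝ) < σ := NNReal.coe_pos.2 hσ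
  refine (measure_mono fun ω hω => ?_).trans ((measure_dotProduct_self_ge_le hσ hε
    (t := 1 / 4) (by norm_num) (n / 2)).trans_eq (congrArg ENNReal.ofReal ?_))
  · have hlt : 2 * (σ : ℝ) ^ 2 * n < ε ω ⬝ᵥ ε ω := hω
    have : 2 * n < ε ω ⬝ᵥ ε ω / (σ : ℝ) ^ 2 := by
      rw [lt_div_iff₀ (by positivity)]
      linarith
    change (n : ℝ) / 2 ≤ 1 / 4 * _
    linarith
  · rw [show (1 - 2 * (1 / 4) : ℝ) = 2⁻¹ by norm_num, Real.rpow_def_of_pos (by norm_num),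
      Real.log_inv, ← Real.exp_add]
    ring_nf

theorem measure_dotProduct_self_lt_le (hσ : 0 < σ)
    (hε : HasLaw ε (Measure.pi fun _ : Fin n => gaussianReal 0 (σ ^ 2)) μ) {s : ℝ} (hs : 0 < s) :
    μ {ω | ε ω ⬝ᵥ ε ω < (1 - s) * (σ : ℝ) ^ 2 * n} ≤
      ENNReal.ofReal (Real.exp (-(s ^ 3 / (1 + s) * n))) := by
  have : (0 : ℝ) < σ := NNReal.coe_pos.2 hσ
  refine (measure_mono fun ω hω => ?_).trans ((measure_dotProduct_self_ge_le hσ hε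
    (t := -s) (by linarith) (-(s * ((1 - s) * n)))).trans (ENNReal.ofReal_le_ofReal ?_))
  · have hlt : ε ω ⬝ᵥ ε ω < (1 - s) * (σ : ℝ) ^ 2 * n := hω
    have : ε ω ⬝ᵥ ε ω / (σ : ℝ) ^ 2 ≤ (1 - s) * n := by
      rw [div_le_iff₀ (by positivity)]
      linarith
    change -(s * ((1 - s) * n)) ≤ -s * _
    rw [neg_mul]
    gcongr
  · have hlog : 2 * s / (1 + s) ≤ Real.log (1 - 2 * -s) := by
      convert Real.le_log_one_add_of_nonneg (x := 2 * s) (by linarith) using 1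
      · field_simp
        ring
      · ring_nf
    have hrate : s ^ 3 / (1 + s) = s / (1 + s) - s * (1 - s) := by field_simp; ring
    rw [Real.rpow_def_of_pos (by linarith), ← Real.exp_add, Real.exp_le_exp, hrate]
    rw [mul_div_assoc] at hlog
    nlinarith [mul_le_mul_of_nonneg_left hlog n.cast_nonneg (α := ℝ)]

variable [IsProbabilityMeasure μ] {X : Ω → Matrix (Fin n) (Fin p) ℝ}

theorem measure_dotProduct_proj_univ_gt_le (hσ : 0 < σ)
    (hX : ∀ i j, Measurable fun ω => X ω i j)
    (hε : HasLaw ε (Measure.pi fun _ : Fin n => gaussianReal 0 (σ ^ 2)) μ)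
    (hindep : IndepFun (fun ω i j => X ω i j) ε μ) {b : ℝ} (hp : p ≤ b / (4 * (σ : ℝ) ^ 2) * n) :
    μ {ω | Function.Injective (X ω).mulVec ∧ b * n < ε ω ⬝ᵥ (proj (X ω) Finset.univ *ᵥ ε ω)} ≤
      ENNReal.ofReal (Real.exp (-(b / (8 * (σ : ℝ) ^ 2) * n))) := by
  have : (0 : ℝ) < σ := NNReal.coe_pos.2 hσ
  refine (measure_mono fun ω hω => ?_).trans ((measure_dotProduct_proj_sub_proj_ge_le hσ hX hε
    hindep (Finset.empty_subset Finset.univ) (t := 1 / 4) (by norm_num)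
    (1 / 4 * (b * n / (σ : ℝ) ^ 2))).trans (ENNReal.ofReal_le_ofReal ?_))
  · refine ⟨hω.1, ?_⟩
    rw [proj_empty, sub_zero]
    gcongr
    exact hω.2.le
  · rw [show (1 - 2 * (1 / 4) : ℝ) = 2⁻¹ by norm_num, Real.rpow_def_of_pos (by norm_num),
      Real.log_inv, ← Real.exp_add, Real.exp_le_exp, Finset.sdiff_empty, Finset.card_univ,
      Fintype.card_fin]
    have hlog : Real.log 2 * p ≤ 1 * p :=
      mul_le_mul_of_nonneg_right (by linarith [Real.log_two_lt_d9]) p.cast_nonneg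
    have hhalf : b / (8 * (σ : ℝ) ^ 2) * n = b / (4 * (σ : ℝ) ^ 2) * n / 2 := by
      field_simp
      ring
    have hr : 1 / 4 * (b * n / (σ : ℝ) ^ 2) = b / (4 * (σ : ℝ) ^ 2) * n := by field_simp
    rw [hhalf, hr]
    linarith

theorem measure_gain_gt_le (hn : 1 ≤ n) (hσ : 0 < σ) (hX : ∀ i j, Measurable fun ω => X ω i j)
    (hε : HasLaw ε (Measure.pi fun _ : Fin n => gaussianReal 0 (σ ^ 2)) μ)
    (hindep : IndepFun (fun ω i j => X ω i j) ε μ) {γ₀ γ : Finset (Fin p)} (hs : γ₀ ⊆ γ)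
    {a : ℝ} (ha : 0 < a) :
    μ {ω | Function.Injective (X ω).mulVec ∧
        (γ \ γ₀).card * (2 * (σ : ℝ) ^ 2 * (1 + a) * Real.log n) <
          ε ω ⬝ᵥ ((proj (X ω) γ - proj (X ω) γ₀) *ᵥ ε ω)} ≤
      ENNReal.ofReal
        (((a / 2 / (1 + a)) ^ (-(1 / 2) : ℝ) * (n : ℝ) ^ (-(1 + a / 2))) ^ (γ \ γ₀).card) := by
  have : (0 : ℝ) < σ := NNReal.coe_pos.2 hσ
  have hn₀ : (0 : ℝ) < n := by exact_mod_cast hn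
  generalize hk : (γ \ γ₀).card = k
  have ht : (1 + a / 2) / (1 + a) / 2 < 1 / 2 := by
    gcongr
    rw [div_lt_one (by linarith)]
    linarith
  have hcompl : 1 - 2 * ((1 + a / 2) / (1 + a) / 2) = a / 2 / (1 + a) := by field_simp; ring
  refine (measure_mono fun ω hω => ?_).trans ((measure_dotProduct_proj_sub_proj_ge_le hσ hX hε
    hindep hs ht ((1 + a / 2) / (1 + a) / 2 *
      (k * (2 * (σ : ℝ) ^ 2 * (1 + a) * Real.log n) / (σ : ℝ) ^ 2))).trans_eq
    (congrArg ENNReal.ofReal ?_))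
  · refine ⟨hω.1, ?_⟩
    gcongr
    exact hω.2.le
  · have hr : (1 + a / 2) / (1 + a) / 2 *
        (k * (2 * (σ : ℝ) ^ 2 * (1 + a) * Real.log n) / (σ : ℝ) ^ 2) =
        Real.log n * ((1 + a / 2) * k) := by field_simp
    rw [hk, hr, hcompl, mul_pow, ← Real.rpow_natCast, ← Real.rpow_natCast,
      ← Real.rpow_mul (by positivity), ← Real.rpow_mul hn₀.le, ← mul_neg,
      ← Real.rpow_def_of_pos hn₀, mul_comm]
    ring_nf

theorem measure_exists_gain_gt_le (hn : 1 ≤ n) (hσ : 0 < σ)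
    (hX : ∀ i j, Measurable fun ω => X ω i j)
    (hε : HasLaw ε (Measure.pi fun _ : Fin n => gaussianReal 0 (σ ^ 2)) μ)
    (hindep : IndepFun (fun ω i j => X ω i j) ε μ) (γ₀ : Finset (Fin p)) {a : ℝ} (ha : 0 < a) :
    μ {ω | Function.Injective (X ω).mulVec ∧ ∃ γ ∈ S₁ γ₀,
        (γ \ γ₀).card * (2 * (σ : ℝ) ^ 2 * (1 + a) * Real.log n) <
          ε ω ⬝ᵥ ((proj (X ω) γ - proj (X ω) γ₀) *ᵥ ε ω)} ≤
      ENNReal.ofReal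
        ((1 + (a / 2 / (1 + a)) ^ (-(1 / 2) : ℝ) * (n : ℝ) ^ (-(1 + a / 2))) ^ p - 1) := by
  set x := (a / 2 / (1 + a)) ^ (-(1 / 2) : ℝ) * (n : ℝ) ^ (-(1 + a / 2))
  have hx : 0 ≤ x := by positivity
  set E : Finset (Fin p) → Set Ω := fun γ => {ω | Function.Injective (X ω).mulVec ∧
    (γ \ γ₀).card * (2 * (σ : ℝ) ^ 2 * (1 + a) * Real.log n) <
      ε ω ⬝ᵥ ((proj (X ω) γ - proj (X ω) γ₀) *ᵥ ε ω)}
  refine (measure_mono (t := ⋃ γ ∈ ({γ | γ₀ ⊂ γ} : Finset (Finset (Fin p))), E γ) ?_).trans ?_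
  · rintro ω ⟨hinj, γ, hγ, hlt⟩
    exact Set.mem_biUnion
      (Finset.mem_coe.2 (Finset.mem_filter.2 ⟨Finset.mem_univ γ, mem_S₁_iff_ssubset.1 hγ⟩))
      ⟨hinj, hlt⟩
  calc μ (⋃ γ ∈ ({γ | γ₀ ⊂ γ} : Finset (Finset (Fin p))), E γ)
      ≤ ∑ γ with γ₀ ⊂ γ, μ (E γ) := measure_biUnion_finset_le _ _
    _ ≤ ∑ γ with γ₀ ⊂ γ, ENNReal.ofReal (x ^ (γ \ γ₀).card) := Finset.sum_le_sum fun γ hγ =>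
        measure_gain_gt_le hn hσ hX hε hindep (Finset.mem_filter.1 hγ).2.subset ha
    _ = ENNReal.ofReal (∑ γ with γ₀ ⊂ γ, x ^ (γ \ γ₀).card) :=
        (ENNReal.ofReal_sum_of_nonneg fun γ _ => pow_nonneg hx _).symm
    _ ≤ _ := ENNReal.ofReal_le_ofReal (sum_pow_card_sdiff_le hx γ₀)

end TypicalNoise

section Asymptotics

variable {p : ℕ → ℕ}

theorem eventually_dim_le_mul
    (hp : (fun n : ℕ => (p n : ℝ) * Real.log n) =o[atTop] fun n : ℕ => (n : ℝ)) {l : ℝ}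
    (hl : 0 < l) : ∀ᶠ n : ℕ in atTop, (p n : ℝ) ≤ l * n := by
  filter_upwards [hp.def hl,
    (Real.tendsto_log_atTop.comp tendsto_natCast_atTop_atTop).eventually_ge_atTop 1] with n hn hlog
  have hlog : 1 ≤ Real.log n := hlog
  rw [Real.norm_of_nonneg (by positivity), Real.norm_of_nonneg n.cast_nonneg] at hn
  exact (le_mul_of_one_le_right (p n).cast_nonneg hlog).trans hn

theorem tendsto_dim_mul_rpow_neg
    (hp : (fun n : ℕ => (p n : ℝ) * Real.log n) =o[atTop] fun n : ℕ => (n : ℝ)) (c : ℝ) {η : ℝ}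
    (hη : 0 < η) : Tendsto (fun n : ℕ => p n * (c * (n : ℝ) ^ (-(1 + η)))) atTop (𝓝 0) := by
  have hdim : (fun n => (p n : ℝ)) =O[atTop] fun n : ℕ => (n : ℝ) := by
    refine IsBigO.of_bound 1 ?_
    filter_upwards [eventually_dim_le_mul hp one_pos] with n hn
    rwa [Real.norm_natCast, Real.norm_natCast]
  have hmul := hdim.mul (isBigO_const_mul_self c (fun n : ℕ => (n : ℝ) ^ (-(1 + η))) atTop)
  refine (hmul.congr' .rfl ?_).trans_tendsto
    ((tendsto_rpow_neg_atTop hη).comp tendsto_natCast_atTop_atTop)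
  filter_upwards [eventually_ge_atTop 1] with n _
  rw [← Real.rpow_one_add' n.cast_nonneg (by linarith)]
  simp

theorem tendsto_one_add_pow_sub_one {x : ℕ → ℝ} (hx : ∀ᶠ n in atTop, 0 ≤ x n)
    (hpx : Tendsto (fun n => p n * x n) atTop (𝓝 0)) :
    Tendsto (fun n => (1 + x n) ^ p n - 1) atTop (𝓝 0) := by
  have hexp : Tendsto (fun n => Real.exp (p n * x n) - 1) atTop (𝓝 0) := by
    simpa using (hpx.rexp).sub_const 1
  refine squeeze_zero' (hx.mono fun n hn => sub_nonneg.2 (one_le_pow₀ (by linarith)))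
    (hx.mono fun n hn => ?_) hexp
  rw [Real.exp_nat_mul, add_comm]
  gcongr
  exact Real.add_one_le_exp _

theorem tendsto_exp_neg_mul_natCast {l : ℝ} (hl : 0 < l) :
    Tendsto (fun n : ℕ => Real.exp (-(l * n))) atTop (𝓝 0) :=
  Real.tendsto_exp_neg_atTop_nhds_zero.comp (tendsto_natCast_atTop_atTop.const_mul_atTop hl)

end Asymptotics

section TypicalNoiseLimit

variable {Ω : Type*} [MeasurableSpace Ω] {μ : Measure Ω} [IsProbabilityMeasure μ] {σ : ℝ≥0}
  {a b : ℝ}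

theorem measure_injective_and_not_typicalNoise_le {n p : ℕ} {X : Ω → Matrix (Fin n) (Fin p) ℝ}
    {ε : Ω → Fin n → ℝ} (hn : 1 ≤ n) (hσ : 0 < σ) (hX : ∀ i j, Measurable fun ω => X ω i j)
    (hε : HasLaw ε (Measure.pi fun _ : Fin n => gaussianReal 0 (σ ^ 2)) μ)
    (hindep : IndepFun (fun ω i j => X ω i j) ε μ) (γ₀ : Finset (Fin p)) (ha : 0 < a)
    (hp : p ≤ b / (4 * (σ : ℝ) ^ 2) * n) :
    μ {ω | Function.Injective (X ω).mulVec ∧ ¬ TypicalNoise γ₀ ((σ : ℝ) ^ 2) a b (X ω) (ε ω)} ≤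
      ENNReal.ofReal (Real.exp (-((a / 2) ^ 3 / (1 + a / 2) * n))) +
      ENNReal.ofReal (Real.exp (-((1 - Real.log 2) / 2 * n))) +
      ENNReal.ofReal (Real.exp (-(b / (8 * (σ : ℝ) ^ 2) * n))) +
      ENNReal.ofReal
        ((1 + (a / 2 / (1 + a)) ^ (-(1 / 2) : ℝ) * (n : ℝ) ^ (-(1 + a / 2))) ^ p - 1) := by
  refine (measure_mono ?_).trans ((measure_union_le _ _).trans (add_le_add
    ((measure_union_le _ _).trans (add_le_add ((measure_union_le _ _).trans (add_le_add
      (measure_dotProduct_self_lt_le hσ hε (half_pos ha)) (measure_dotProduct_self_gt_le hσ hε)))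
      (measure_dotProduct_proj_univ_gt_le hσ hX hε hindep hp)))
    (measure_exists_gain_gt_le hn hσ hX hε hindep γ₀ ha)))
  rintro ω ⟨hinj, hω⟩
  by_contra hnot
  simp only [Set.mem_union, Set.mem_ofPred, not_or, not_and, not_lt, not_exists] at hnot
  obtain ⟨⟨⟨hlow, hupp⟩, hproj⟩, hgain⟩ := hnot
  exact hω ⟨hlow, hupp, hproj hinj, hgain hinj⟩

theorem tendsto_measure_injective_and_not_typicalNoise {p : ℕ → ℕ}
    {X : ∀ n, Ω → Matrix (Fin n) (Fin (p n)) ℝ} {ε : ∀ n, Ω → Fin n → ℝ} (hσ : 0 < σ)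
    (hX : ∀ n, 1 ≤ n → ∀ i j, Measurable fun ω => X n ω i j)
    (hε : ∀ n, 1 ≤ n → HasLaw (ε n) (Measure.pi fun _ : Fin n => gaussianReal 0 (σ ^ 2)) μ)
    (hindep : ∀ n, 1 ≤ n → IndepFun (fun ω i j => X n ω i j) (ε n) μ)
    (hp : (fun n : ℕ => (p n : ℝ) * Real.log n) =o[atTop] fun n : ℕ => (n : ℝ))
    (γ₀ : ∀ n, Finset (Fin (p n))) (ha : 0 < a) (hb : 0 < b) :
    Tendsto (fun n => μ {ω | Function.Injective (X n ω).mulVec ∧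
      ¬ TypicalNoise (γ₀ n) ((σ : ℝ) ^ 2) a b (X n ω) (ε n ω)}) atTop (𝓝 0) := by
  have : (0 : ℝ) < σ := NNReal.coe_pos.2 hσ
  have hgain := tendsto_one_add_pow_sub_one
    (x := fun n : ℕ => (a / 2 / (1 + a)) ^ (-(1 / 2) : ℝ) * (n : ℝ) ^ (-(1 + a / 2)))
    (.of_forall fun n => by positivity) (tendsto_dim_mul_rpow_neg hp _ (half_pos ha))
  have hsum := (((ENNReal.tendsto_ofReal (tendsto_exp_neg_mul_natCast
    (l := (a / 2) ^ 3 / (1 + a / 2)) (by positivity))).add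
    (ENNReal.tendsto_ofReal (tendsto_exp_neg_mul_natCast
      (l := (1 - Real.log 2) / 2) (by linarith [Real.log_two_lt_d9])))).add
    (ENNReal.tendsto_ofReal (tendsto_exp_neg_mul_natCast
      (l := b / (8 * (σ : ℝ) ^ 2)) (by positivity)))).add (ENNReal.tendsto_ofReal hgain)
  simp only [ENNReal.ofReal_zero, add_zero] at hsum
  refine tendsto_of_tendsto_of_tendsto_of_le_of_le' tendsto_const_nhds hsum
    (.of_forall fun _ => zero_le) ?_
  filter_upwards [eventually_ge_atTop 1,
    eventually_dim_le_mul hp (l := b / (4 * (σ : ℝ) ^ 2)) (by positivity)] with n hn hdim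
  exact measure_injective_and_not_typicalNoise_le hn hσ (hX n hn) (hε n hn) (hindep n hn) (γ₀ n)
    ha hdim

end TypicalNoiseLimit

section Posterior

variable {n p : ℕ} {ν : ℝ} {prior : PMF (Finset (Fin p))} {c : Fin p → ℝ}
  {X : Matrix (Fin n) (Fin p) ℝ} {γ₀ γ : Finset (Fin p)}

theorem postWeight_eq (hc : ∀ j, 0 < c j) (ν : ℝ) (prior : PMF (Finset (Fin p)))
    (X : Matrix (Fin n) (Fin p) ℝ) (y : Fin n → ℝ) (γ : Finset (Fin p)) :
    postWeight ν prior c X y γ = (2 * Real.pi) ^ (-(n : ℝ) / 2) *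
      (margCov c X γ).det ^ (-(1 / 2) : ℝ) * (prior γ).toReal *
      (2 / (1 + penalizedRss c X y γ)) ^ (((n : ℝ) + ν) / 2) := by
  rw [postWeight, penalizedRss, margCov_inv hc, det_margCov hc]

theorem postWeight_nonneg (hc : ∀ j, 0 < c j) (ν : ℝ) (prior : PMF (Finset (Fin p)))
    (X : Matrix (Fin n) (Fin p) ℝ) (y : Fin n → ℝ) (γ : Finset (Fin p)) :
    0 ≤ postWeight ν prior c X y γ := by
  have hrss := penalizedRss_nonneg hc X y γ
  have hdet := one_le_det_margCov hc X γ
  rw [postWeight_eq hc]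
  positivity

theorem postWeight_pos (hc : ∀ j, 0 < c j) (ν : ℝ) (X : Matrix (Fin n) (Fin p) ℝ)
    (y : Fin n → ℝ) (hprior : prior γ ≠ 0) : 0 < postWeight ν prior c X y γ := by
  have hrss := penalizedRss_nonneg hc X y γ
  have hdet := one_le_det_margCov hc X γ
  have hpos : 0 < (prior γ).toReal := ENNReal.toReal_pos hprior (prior.apply_ne_top γ)
  rw [postWeight_eq hc]
  positivity

theorem postWeight_le_mul {y : Fin n → ℝ} {C d ρ : ℝ} (hν : 0 < ν) (hc : ∀ j, 0 < c j)
    (hd : 0 < d) (hρ : 0 ≤ ρ) (hprior : (prior γ).toReal ≤ C * (prior γ₀).toReal)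
    (hdet : (margCov c X γ₀).det * d ≤ (margCov c X γ).det)
    (hrss : 1 + penalizedRss c X y γ₀ ≤ ρ * (1 + penalizedRss c X y γ)) :
    postWeight ν prior c X y γ ≤
      postWeight ν prior c X y γ₀ * (C * d ^ (-(1 / 2) : ℝ) * ρ ^ (((n : ℝ) + ν) / 2)) := by
  have hrss₀ := penalizedRss_nonneg hc X y γ₀
  have hrss₁ := penalizedRss_nonneg hc X y γ
  have hdet₀ := one_le_det_margCov hc X γ₀
  have := one_le_det_margCov hc X γ
  have hdet_rpow : (margCov c X γ).det ^ (-(1 / 2) : ℝ) ≤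
      (margCov c X γ₀).det ^ (-(1 / 2) : ℝ) * d ^ (-(1 / 2) : ℝ) := by
    rw [← Real.mul_rpow (by positivity) hd.le]
    exact Real.rpow_le_rpow_of_nonpos (by positivity) hdet (by norm_num)
  have hrss_rpow : (2 / (1 + penalizedRss c X y γ)) ^ (((n : ℝ) + ν) / 2) ≤
      (2 / (1 + penalizedRss c X y γ₀)) ^ (((n : ℝ) + ν) / 2) * ρ ^ (((n : ℝ) + ν) / 2) := by
    rw [← Real.mul_rpow (by positivity) hρ]
    refine Real.rpow_le_rpow (by positivity) ?_ (by positivity)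
    rw [div_mul_eq_mul_div, div_le_div_iff₀ (by positivity) (by positivity)]
    linarith
  rw [postWeight_eq hc, postWeight_eq hc]
  calc _ ≤ (2 * Real.pi) ^ (-(n : ℝ) / 2) *
        ((margCov c X γ₀).det ^ (-(1 / 2) : ℝ) * d ^ (-(1 / 2) : ℝ)) * (C * (prior γ₀).toReal) *
        ((2 / (1 + penalizedRss c X y γ₀)) ^ (((n : ℝ) + ν) / 2) * ρ ^ (((n : ℝ) + ν) / 2)) := by
        have := ENNReal.toReal_nonneg.trans hprior
        gcongr
    _ = _ := by ring

theorem posterior_le_one (hc : ∀ j, 0 < c j) (ν : ℝ) (prior : PMF (Finset (Fin p)))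
    (X : Matrix (Fin n) (Fin p) ℝ) (y : Fin n → ℝ) (γ : Finset (Fin p)) :
    posterior ν prior c X y γ ≤ 1 :=
  div_le_one_of_le₀ (Finset.single_le_sum (fun γ' _ => postWeight_nonneg hc ν prior X y γ')
    (Finset.mem_univ γ)) (Finset.sum_nonneg fun γ' _ => postWeight_nonneg hc ν prior X y γ')

theorem sum_eq_add_sum_ssubset_add_sum_not_subset {M : Type*} [AddCommMonoid M]
    (γ₀ : Finset (Fin p)) (f : Finset (Fin p) → M) :
    ∑ γ, f γ = f γ₀ + ∑ γ with γ₀ ⊂ γ, f γ + ∑ γ with ¬ γ₀ ⊆ γ, f γ := by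
  rw [← Finset.sum_filter_add_sum_filter_not Finset.univ (γ₀ ⊆ ·) f]
  congr 1
  have hsubset : ({γ | γ₀ ⊆ γ} : Finset (Finset (Fin p))) =
      insert γ₀ ({γ | γ₀ ⊂ γ} : Finset (Finset (Fin p))) := by
    ext γ
    simp [subset_iff_ssubset_or_eq, or_comm, eq_comm]
  rw [hsubset, Finset.sum_insert (by simp)]

theorem one_sub_le_posterior {y : Fin n → ℝ} {A B x : ℝ} (hc : ∀ j, 0 < c j)
    (hprior : prior γ₀ ≠ 0) (hA : 0 ≤ A) (hB : 0 ≤ B) (hx : 0 ≤ x)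
    (hover : ∀ γ ∈ S₁ γ₀, postWeight ν prior c X y γ ≤
      postWeight ν prior c X y γ₀ * (A * x ^ (γ \ γ₀).card))
    (hunder : ∀ γ ∈ S₂ γ₀, postWeight ν prior c X y γ ≤ postWeight ν prior c X y γ₀ * B) :
    1 - (A * ((1 + x) ^ p - 1) + 2 ^ p * B) ≤ posterior ν prior c X y γ₀ := by
  have hpos := postWeight_pos hc ν X y hprior
  set w := postWeight ν prior c X y
  set T := A * ((1 + x) ^ p - 1) + 2 ^ p * B
  have hT : 0 ≤ T := add_nonneg
    (mul_nonneg hA (sub_nonneg.2 (one_le_pow₀ (by linarith)))) (by positivity)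
  have hsum₁ : ∑ γ with γ₀ ⊂ γ, w γ ≤ w γ₀ * (A * ((1 + x) ^ p - 1)) := calc
    _ ≤ ∑ γ with γ₀ ⊂ γ, w γ₀ * (A * x ^ (γ \ γ₀).card) := Finset.sum_le_sum fun γ hγ =>
      hover γ (mem_S₁_iff_ssubset.2 (Finset.mem_filter.1 hγ).2)
    _ = w γ₀ * (A * ∑ γ with γ₀ ⊂ γ, x ^ (γ \ γ₀).card) := by simp_rw [Finset.mul_sum]
    _ ≤ _ := by gcongr; exact sum_pow_card_sdiff_le hx γ₀
  have hsum₂ : ∑ γ with ¬ γ₀ ⊆ γ, w γ ≤ w γ₀ * (2 ^ p * B) := calc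
    _ ≤ ∑ γ with ¬ γ₀ ⊆ γ, w γ₀ * B := Finset.sum_le_sum fun γ hγ =>
      hunder γ (Finset.mem_filter.1 hγ).2
    _ ≤ ∑ _γ : Finset (Fin p), w γ₀ * B :=
      Finset.sum_le_univ_sum_of_nonneg fun _ => by positivity
    _ = _ := by simp [mul_left_comm]
  have hsum : ∑ γ, w γ ≤ w γ₀ * (1 + T) := by
    rw [sum_eq_add_sum_ssubset_add_sum_not_subset γ₀ w]
    linarith
  calc 1 - T ≤ w γ₀ / (w γ₀ * (1 + T)) := by
        rw [← div_div, div_self hpos.ne', le_div_iff₀ (by positivity)]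
        linarith [sq_nonneg T]
    _ ≤ w γ₀ / ∑ γ, w γ := div_le_div_of_nonneg_left hpos.le
        (hpos.trans_le (Finset.single_le_sum (fun γ _ => postWeight_nonneg hc ν prior X y γ)
          (Finset.mem_univ γ₀))) hsum

end Posterior

theorem add_le_exp_div_mul {L s u : ℝ} (hL : 0 < L) (hs : L ≤ s) (hu : 0 ≤ u) :
    s + u ≤ Real.exp (u / L) * s := by
  have hus : u ≤ u / L * s := by
    rw [div_mul_eq_mul_div, le_div_iff₀ hL]
    gcongr
  calc s + u ≤ (u / L + 1) * s := by linarith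
    _ ≤ _ := mul_le_mul_of_nonneg_right (Real.add_one_le_exp _) (hL.le.trans hs)

theorem le_div_add_mul_of_add_le {Λ d r s : ℝ} (hΛ : 0 < Λ) (hd : 0 ≤ d) (hr : r ≤ Λ)
    (hs : r + d ≤ s) : r ≤ Λ / (Λ + d) * s := by
  rw [div_mul_eq_mul_div, le_div_iff₀ (by positivity)]
  calc r * (Λ + d) ≤ Λ * (r + d) := by linarith [mul_le_mul_of_nonneg_right hr hd]
    _ ≤ Λ * s := by gcongr

section PosteriorOdds

variable {n p : ℕ} {ν : ℝ} {prior : PMF (Finset (Fin p))} {c : Fin p → ℝ}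
  {X : Matrix (Fin n) (Fin p) ℝ} {β : Fin p → ℝ} {e : Fin n → ℝ} {γ₀ γ : Finset (Fin p)}
  {C g G h t K v a b m : ℝ}

theorem dotProduct_proj_mulVec_mono {γ' : Finset (Fin p)}
    (hγ' : Function.Injective (cols X γ').mulVec) (hs : γ ⊆ γ') (e : Fin n → ℝ) :
    e ⬝ᵥ (proj X γ *ᵥ e) ≤ e ⬝ᵥ (proj X γ' *ᵥ e) := by
  have hdiff := (isStarProjection_proj X γ).sub_of_mul_eq_right (isStarProjection_proj X γ')
    (proj_mul_proj_of_subset hγ' hs)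
  exact dotProduct_mulVec_mono (sub_nonneg.1 hdiff.nonneg) e

theorem TypicalNoise.le_dotProduct_one_sub_proj_mulVec (hT : TypicalNoise γ₀ v a b X e)
    (hX : Function.Injective X.mulVec) (hb : b ≤ a / 2 * v) (γ : Finset (Fin p)) :
    (1 - a) * v * n ≤ e ⬝ᵥ ((1 - proj X γ) *ᵥ e) := by
  have hmono := dotProduct_proj_mulVec_mono (mulVec_injective_cols hX Finset.univ)
    (Finset.subset_univ γ) e
  have hbn : b * n ≤ a / 2 * v * n := by gcongr
  rw [sub_mulVec, one_mulVec, dotProduct_sub]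
  linarith [hT.le_dotProduct_self, hT.dotProduct_proj_univ_le]

theorem penalizedRss_stateOf_le_of_typicalNoise (hn : 1 ≤ n) (ht : 0 < t) (htc : ∀ j, t ≤ c j)
    (hg : 0 < g) (hgram : (n * g) • 1 ≤ (cols X (stateOf β))ᵀ * cols X (stateOf β))
    (hT : TypicalNoise (stateOf β) v a b X e)
    (hK : (2 * ∑ j ∈ stateOf β, β j ^ 2 + 4 * v / g) / t ≤ K) :
    penalizedRss c X (X *ᵥ β + e) (stateOf β) ≤ e ⬝ᵥ ((1 - proj X (stateOf β)) *ᵥ e) + K := by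
  have : (0 : ℝ) < n := by exact_mod_cast hn
  refine (penalizedRss_stateOf_le ht htc (by positivity) hgram e).trans
    (add_le_add le_rfl (le_trans ?_ hK))
  have hnoise : 2 * (e ⬝ᵥ e / (n * g)) ≤ 4 * v / g := calc
    _ ≤ 2 * (2 * v * n / (n * g)) := by gcongr; exact hT.dotProduct_self_le
    _ = 4 * v / g := by field_simp; ring
  gcongr

theorem one_add_penalizedRss_le_of_mem_S₁ (hn : 1 ≤ n) (ht : 0 < t) (htc : ∀ j, t ≤ c j)
    (hv : 0 < v) (ha₀ : 0 < a) (ha₁ : a < 1) (hb : b ≤ a / 2 * v) (hg : 0 < g)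
    (hgram : (n * g) • 1 ≤ (cols X (stateOf β))ᵀ * cols X (stateOf β))
    (hX : Function.Injective X.mulVec) (hT : TypicalNoise (stateOf β) v a b X e)
    (hK : (2 * ∑ j ∈ stateOf β, β j ^ 2 + 4 * v / g) / t ≤ K)
    (hγ : γ ∈ S₁ (stateOf β)) :
    1 + penalizedRss c X (X *ᵥ β + e) (stateOf β) ≤
      Real.exp ((K + (γ \ stateOf β).card * (2 * v * (1 + a) * Real.log n)) /
        ((1 - a) * v * n)) * (1 + penalizedRss c X (X *ᵥ β + e) γ) := by
  have hn₀ : (0 : ℝ) < n := by exact_mod_cast hn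
  have : 0 ≤ Real.log n := Real.log_natCast_nonneg n
  have hK₀ : 0 ≤ K := le_trans (by positivity) hK
  have hL : 0 < (1 - a) * v * n := mul_pos (mul_pos (sub_pos.2 ha₁) hv) hn₀
  have htrue := penalizedRss_stateOf_le_of_typicalNoise hn ht htc hg hgram hT hK
  have hover := le_penalizedRss_of_subset (fun j => ht.trans_le (htc j)) hγ.1
    (mulVec_injective_cols hX γ) e
  have hresid := hT.le_dotProduct_one_sub_proj_mulVec hX hb γ
  have hgain := hT.gain_le γ hγ
  refine le_trans ?_ (add_le_exp_div_mul hL (s := 1 + penalizedRss c X (X *ᵥ β + e) γ)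
    (by linarith) (by positivity))
  simp only [sub_mulVec, one_mulVec, dotProduct_sub] at htrue hover hgain
  linarith

theorem exp_div_rpow_half_le (hn : 1 ≤ n) (hv : 0 < v) (ha₀ : 0 < a) (ha₁ : a < 1)
    (hνn : ν ≤ a * n) (hK₀ : 0 ≤ K) (k : ℕ) :
    Real.exp ((K + k * (2 * v * (1 + a) * Real.log n)) / ((1 - a) * v * n)) ^ ((n + ν) / 2) ≤
      Real.exp ((1 + a) / (2 * (1 - a) * v) * K) * ((n : ℝ) ^ ((1 + a) ^ 2 / (1 - a))) ^ k := by
  have hn₁ : (1 : ℝ) ≤ n := by exact_mod_cast hn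
  have hn₀ : (0 : ℝ) < n := by linarith
  have : 0 ≤ Real.log n := Real.log_natCast_nonneg n
  have ha : 0 < 1 - a := sub_pos.2 ha₁
  rw [← Real.exp_mul, Real.rpow_def_of_pos hn₀, ← Real.exp_nat_mul, ← Real.exp_add,
    Real.exp_le_exp]
  calc (K + k * (2 * v * (1 + a) * Real.log n)) / ((1 - a) * v * n) * ((n + ν) / 2)
      ≤ (K + k * (2 * v * (1 + a) * Real.log n)) / ((1 - a) * v * n) * ((n + a * n) / 2) := by
        gcongr
    _ = (1 + a) / (2 * (1 - a) * v) * K +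
        k * (Real.log n * ((1 + a) ^ 2 / (1 - a))) := by
        field_simp

theorem postWeight_le_of_mem_S₁ (hn : 1 ≤ n) (hν : 0 < ν) (hνn : ν ≤ a * n) (ht : 0 < t)
    (htc : ∀ j, t ≤ c j) (hv : 0 < v) (ha₀ : 0 < a) (ha₁ : a < 1) (hb : b ≤ a / 2 * v)
    (hg : 0 < g) (hh : 0 < h) (h₀ : (stateOf β).Nonempty)
    (hC : 0 ≤ C) (hprior : (prior γ).toReal ≤ C * (prior (stateOf β)).toReal)
    (hR : RegularDesign (stateOf β) (n * g) G h X) (hT : TypicalNoise (stateOf β) v a b X e)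
    (hK : (2 * ∑ j ∈ stateOf β, β j ^ 2 + 4 * v / g) / t ≤ K) (hγ : γ ∈ S₁ (stateOf β)) :
    postWeight ν prior c X (X *ᵥ β + e) γ ≤ postWeight ν prior c X (X *ᵥ β + e) (stateOf β) *
      (C * Real.exp ((1 + a) / (2 * (1 - a) * v) * K) *
        ((n : ℝ) ^ ((1 + a) ^ 2 / (1 - a)) * (h * t) ^ (-(1 / 2) : ℝ)) ^
          (γ \ stateOf β).card) := by
  have : (0 : ℝ) < n := by exact_mod_cast hn
  have hc (j : Fin p) : 0 < c j := ht.trans_le (htc j)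
  have hX := hR.mulVec_injective h₀ (by positivity) hh
  have hdet := det_margCov_mul_le ht htc hh.le hγ.1 (mulVec_injective_cols hX _)
    (hR.le_of_mem_S₁ γ hγ)
  have hrss := one_add_penalizedRss_le_of_mem_S₁ hn ht htc hv ha₀ ha₁ hb hg (hR.le_gram h₀) hX hT
    hK hγ
  refine (postWeight_le_mul hν hc (by positivity) (Real.exp_nonneg _) hprior hdet hrss).trans
    (mul_le_mul_of_nonneg_left ?_ (postWeight_nonneg hc _ _ _ _ _))
  rw [← Real.rpow_pow_comm (by positivity), mul_pow]
  calc _ ≤ C * ((h * t) ^ (-(1 / 2) : ℝ)) ^ (γ \ stateOf β).card *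
        (Real.exp ((1 + a) / (2 * (1 - a) * v) * K) *
          ((n : ℝ) ^ ((1 + a) ^ 2 / (1 - a))) ^ (γ \ stateOf β).card) := by
        gcongr
        exact exp_div_rpow_half_le hn hv ha₀ ha₁ hνn (le_trans (by positivity) hK) _
    _ = _ := by ring

theorem one_add_penalizedRss_le_of_mem_S₂ (hn : 1 ≤ n) (ht : 0 < t) (htc : ∀ j, t ≤ c j)
    (hv : 0 < v) (hm : 0 ≤ m) (hβ : ∀ j ∈ stateOf β, m ≤ |β j|) (hb : b ≤ g * m ^ 2 / 16)
    (hg : 0 < g) (hR : RegularDesign (stateOf β) (n * g) G h X) (h₀ : (stateOf β).Nonempty)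
    (hX : Function.Injective X.mulVec) (hT : TypicalNoise (stateOf β) v a b X e)
    (hK : (2 * ∑ j ∈ stateOf β, β j ^ 2 + 4 * v / g) / t ≤ K) (hKv : 1 + K ≤ v * n)
    (hKm : K ≤ g * m ^ 2 / 8 * n) (hγ : γ ∈ S₂ (stateOf β)) :
    1 + penalizedRss c X (X *ᵥ β + e) (stateOf β) ≤
      12 * v / (12 * v + g * m ^ 2) * (1 + penalizedRss c X (X *ᵥ β + e) γ) := by
  have : (0 : ℝ) < n := by exact_mod_cast hn
  have htrue := penalizedRss_stateOf_le_of_typicalNoise hn ht htc hg (hR.le_gram h₀) hT hK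
  have hunder := le_penalizedRss_of_not_subset (fun j => ht.trans_le (htc j)) hX hγ
    (by positivity) hm hβ (hR.le_of_mem_S₂ γ hγ) e
  have hproj := dotProduct_mulVec_le_of_isStarProjection
    (isStarProjection_proj X (stateOf β)).one_sub e
  have hbn : b * n ≤ g * m ^ 2 / 16 * n := by gcongr
  have hratio : 12 * v / (12 * v + g * m ^ 2) =
      3 * v * n / (3 * v * n + g * m ^ 2 / 4 * n) := by
    field_simp
    ring
  rw [hratio]
  refine le_div_add_mul_of_add_le (by positivity) (by positivity) ?_ ?_
  · linarith [hT.dotProduct_self_le]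
  · linarith [hT.dotProduct_proj_univ_le]

theorem postWeight_le_of_mem_S₂ (hn : 1 ≤ n) (hν : 0 < ν) (ht : 0 < t)
    (htc : ∀ j, t ≤ c j) {T : ℝ} (hcT : ∀ j, c j ≤ T) (hv : 0 < v) (hm : 0 ≤ m)
    (hβ : ∀ j ∈ stateOf β, m ≤ |β j|) (hb : b ≤ g * m ^ 2 / 16) (hg : 0 < g) (hG : 0 ≤ G)
    (hh : 0 < h) (h₀ : (stateOf β).Nonempty)
    (hprior : (prior γ).toReal ≤ C * (prior (stateOf β)).toReal)
    (hR : RegularDesign (stateOf β) (n * g) G h X) (hT : TypicalNoise (stateOf β) v a b X e)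
    (hK : (2 * ∑ j ∈ stateOf β, β j ^ 2 + 4 * v / g) / t ≤ K) (hKv : 1 + K ≤ v * n)
    (hKm : K ≤ g * m ^ 2 / 8 * n) (hγ : γ ∈ S₂ (stateOf β)) :
    postWeight ν prior c X (X *ᵥ β + e) γ ≤ postWeight ν prior c X (X *ᵥ β + e) (stateOf β) *
      (C * ((1 + G * T) ^ p) ^ (1 / 2 : ℝ) *
        (12 * v / (12 * v + g * m ^ 2)) ^ ((n + ν) / 2)) := by
  have : (0 : ℝ) < n := by exact_mod_cast hn
  have hc (j : Fin p) : 0 < c j := ht.trans_le (htc j)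
  have hX := hR.mulVec_injective h₀ (by positivity) hh
  have hT₀ : 0 ≤ T := h₀.elim fun j _ => (hc j).le.trans (hcT j)
  have hdet₀ : (margCov c X (stateOf β)).det ≤ (1 + G * T) ^ p :=
    (det_margCov_le hc hcT hG hR.gram_le).trans
      (pow_le_pow_right₀ (by linarith [mul_nonneg hG hT₀])
        ((Finset.card_le_univ _).trans_eq (Fintype.card_fin p)))
  have hdet : (margCov c X (stateOf β)).det * ((1 + G * T) ^ p)⁻¹ ≤ (margCov c X γ).det := by
    refine le_trans ?_ (one_le_det_margCov hc X γ)
    rw [← div_eq_mul_inv]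
    exact div_le_one_of_le₀ hdet₀ (by positivity)
  have hrss := one_add_penalizedRss_le_of_mem_S₂ hn ht htc hv hm hβ hb hg hR h₀ hX hT hK hKv hKm
    hγ
  have hle := postWeight_le_mul hν hc (by positivity) (by positivity) hprior hdet hrss
  rwa [Real.inv_rpow (by positivity), Real.rpow_neg (by positivity), inv_inv] at hle

end PosteriorOdds

section Rates

variable {p : ℕ → ℕ} {δ δ₀ : ℝ} {φ : ℕ → ℝ}

theorem exists_forall_eventually_div_le {s : ℕ → ℝ} (hδ₀ : 0 < δ₀) (hφ : ∀ n, 1 ≤ n → 0 < φ n)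
    (hs : s =O[atTop] fun n : ℕ => (n : ℝ) ^ δ₀)
    (hφO : (fun n : ℕ => (n : ℝ) ^ δ₀) =O[atTop] φ) (q : ℝ) :
    ∃ K, ∀ᶠ n in atTop, (2 * s n + q) / φ n ≤ K := by
  have hq : (fun _ : ℕ => q) =O[atTop] fun n : ℕ => (n : ℝ) ^ δ₀ :=
    ((isLittleO_const_left.2 (.inr (tendsto_norm_atTop_atTop.comp
      ((tendsto_rpow_atTop hδ₀).comp tendsto_natCast_atTop_atTop)))).isBigO)
  obtain ⟨K, hK⟩ := (((hs.const_mul_left 2).add hq).trans hφO).bound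
  refine ⟨K, ?_⟩
  filter_upwards [hK, eventually_ge_atTop 1] with n hn hn₁
  rw [Real.norm_of_nonneg (hφ n hn₁).le] at hn
  exact (div_le_iff₀ (hφ n hn₁)).2 ((le_abs_self _).trans hn)

theorem exists_mem_Ioo_two_mul_sq_div_lt {r : ℝ} (hr : 2 < r) :
    ∃ a ∈ Set.Ioo (0 : ℝ) 1, 2 * ((1 + a) ^ 2 / (1 - a)) < r := by
  have hcont : ContinuousAt (fun a : ℝ => 2 * ((1 + a) ^ 2 / (1 - a))) 0 := by
    fun_prop (disch := norm_num)
  have hlt : ∀ᶠ a in 𝓝[>] (0 : ℝ), 2 * ((1 + a) ^ 2 / (1 - a)) < r :=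
    (hcont.eventually_lt continuousAt_const (by norm_num [hr])).filter_mono nhdsWithin_le_nhds
  have hIoo : ∀ᶠ a in 𝓝[>] (0 : ℝ), a ∈ Set.Ioo 0 1 := Ioo_mem_nhdsGT one_pos
  exact (hIoo.and hlt).exists

theorem tendsto_dim_mul_rpow_mul_rpow_neg_half
    (hp : (fun n : ℕ => (p n : ℝ) * Real.log n) =o[atTop] fun n : ℕ => (n : ℝ))
    {s c : ℝ} (hs : 2 * s + 1 + δ < δ₀) (hc : 0 < c) (hφ : ∀ n, 1 ≤ n → 0 < φ n)
    (hφO : (fun n : ℕ => (n : ℝ) ^ δ₀) =O[atTop] φ) :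
    Tendsto (fun n : ℕ => p n * ((n : ℝ) ^ s *
      (n * (c * (n : ℝ) ^ (-δ)) * φ n) ^ (-(1 / 2) : ℝ))) atTop (𝓝 0) := by
  obtain ⟨M, hM, hMφ⟩ := hφO.exists_pos
  have hη : 0 < (δ₀ - (2 * s + 1 + δ)) / 2 := by linarith
  refine squeeze_zero' ?_ ?_ (tendsto_dim_mul_rpow_neg hp ((c / M) ^ (-(1 / 2) : ℝ)) hη)
  · filter_upwards [eventually_ge_atTop 1] with n hn
    have := hφ n hn
    positivity
  filter_upwards [hMφ.bound, eventually_ge_atTop 1] with n hn hn₁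
  have hn₀ : (0 : ℝ) < n := by exact_mod_cast hn₁
  have hφn := hφ n hn₁
  rw [Real.norm_of_nonneg (by positivity), Real.norm_of_nonneg hφn.le] at hn
  have hgrowth : c / M * (n : ℝ) ^ (1 - δ + δ₀) ≤ n * (c * (n : ℝ) ^ (-δ)) * φ n := calc
    _ = n * (c * (n : ℝ) ^ (-δ)) * ((n : ℝ) ^ δ₀ / M) := by
      rw [sub_eq_add_neg, Real.rpow_add hn₀, Real.rpow_add hn₀, Real.rpow_one]
      ring
    _ ≤ _ := by
      gcongr
      exact (div_le_iff₀' hM).2 hn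
  refine mul_le_mul_of_nonneg_left ?_ (p n).cast_nonneg
  calc (n : ℝ) ^ s * (n * (c * (n : ℝ) ^ (-δ)) * φ n) ^ (-(1 / 2) : ℝ)
      ≤ (n : ℝ) ^ s * (c / M * (n : ℝ) ^ (1 - δ + δ₀)) ^ (-(1 / 2) : ℝ) :=
        mul_le_mul_of_nonneg_left
          (Real.rpow_le_rpow_of_nonpos (by positivity) hgrowth (by norm_num)) (by positivity)
    _ = (c / M) ^ (-(1 / 2) : ℝ) * (n : ℝ) ^ (s + (1 - δ + δ₀) * (-(1 / 2))) := by
        rw [Real.mul_rpow (by positivity) (by positivity), ← Real.rpow_mul hn₀.le,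
          Real.rpow_add hn₀]
        ring
    _ = (c / M) ^ (-(1 / 2) : ℝ) * (n : ℝ) ^ (-(1 + (δ₀ - (2 * s + 1 + δ)) / 2)) := by
        congr 2
        ring

theorem eventually_one_add_mul_le_rpow {G : ℝ} (hG : 0 ≤ G) (hδ₀ : 0 ≤ δ₀)
    (hφO : φ =O[atTop] fun n : ℕ => (n : ℝ) ^ δ₀) :
    ∀ᶠ n : ℕ in atTop, 1 + n * G * φ n ≤ (n : ℝ) ^ (δ₀ + 2) := by
  obtain ⟨M, _, hMφ⟩ := hφO.exists_pos
  filter_upwards [hMφ.bound, eventually_ge_atTop 1, eventually_ge_atTop ⌈1 + G * M⌉₊] with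
    n hφn hn hnM
  have hn₁ : (1 : ℝ) ≤ n := by exact_mod_cast hn
  have hpow : 1 ≤ n * (n : ℝ) ^ δ₀ := one_le_mul_of_one_le_of_one_le hn₁ (Real.one_le_rpow hn₁ hδ₀)
  rw [Real.norm_eq_abs, Real.norm_of_nonneg (r := (n : ℝ) ^ δ₀) (by positivity)] at hφn
  calc 1 + n * G * φ n
      ≤ n * (n : ℝ) ^ δ₀ + n * G * (M * (n : ℝ) ^ δ₀) :=
        add_le_add hpow (mul_le_mul_of_nonneg_left ((le_abs_self _).trans hφn) (by positivity))
    _ = (1 + G * M) * (n * (n : ℝ) ^ δ₀) := by ring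
    _ ≤ n * (n * (n : ℝ) ^ δ₀) := by
        gcongr
        exact Nat.ceil_le.1 hnM
    _ = (n : ℝ) ^ (δ₀ + 2) := by
        rw [Real.rpow_add (by positivity), Real.rpow_two]
        ring

theorem two_pow_le_exp_mul_log {n d : ℕ} (hn : 1 ≤ Real.log n) :
    (2 : ℝ) ^ d ≤ Real.exp (d * Real.log n) := by
  rw [Real.exp_nat_mul]
  gcongr
  linarith [Real.add_one_le_exp (Real.log n)]

theorem pow_rpow_half_le_exp_mul_log {n d : ℕ} {x κ : ℝ} (hn : 1 ≤ n) (hx : 0 ≤ x)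
    (hxn : x ≤ (n : ℝ) ^ κ) :
    (x ^ d) ^ (1 / 2 : ℝ) ≤ Real.exp (d * Real.log n * (κ / 2)) := by
  have hn₀ : (0 : ℝ) < n := by exact_mod_cast hn
  calc (x ^ d) ^ (1 / 2 : ℝ)
      ≤ (((n : ℝ) ^ κ) ^ d) ^ (1 / 2 : ℝ) := by gcongr
    _ = Real.exp (d * Real.log n * (κ / 2)) := by
        rw [← Real.rpow_natCast, ← Real.rpow_mul (by positivity), ← Real.rpow_mul hn₀.le,
          Real.rpow_def_of_pos hn₀]
        congr 1
        ring

theorem tendsto_two_pow_mul_rpow_mul_rpow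
    (hp : (fun n : ℕ => (p n : ℝ) * Real.log n) =o[atTop] fun n : ℕ => (n : ℝ))
    {ν C G q : ℝ} (hν : 0 ≤ ν) (hC : 0 ≤ C) (hG : 0 ≤ G) (hq₀ : 0 < q) (hq₁ : q < 1)
    (hδ₀ : 0 ≤ δ₀) (hφ : ∀ n, 1 ≤ n → 0 < φ n)
    (hφO : φ =O[atTop] fun n : ℕ => (n : ℝ) ^ δ₀) :
    Tendsto (fun n : ℕ => 2 ^ p n * (C * ((1 + n * G * φ n) ^ p n) ^ (1 / 2 : ℝ) *
      q ^ ((n + ν) / 2))) atTop (𝓝 0) := by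
  have hlog : Real.log q < 0 := Real.log_neg hq₀ hq₁
  set l := -Real.log q / (4 * (1 + (δ₀ + 2) / 2)) with hl
  have hl₀ : 0 < l := div_pos (by linarith) (by positivity)
  have hlq : l * (1 + (δ₀ + 2) / 2) = -Real.log q / 4 := by
    rw [hl]
    field_simp
  have hlim := (tendsto_exp_neg_mul_natCast (l := -Real.log q / 4) (by linarith)).const_mul C
  rw [mul_zero] at hlim
  refine squeeze_zero' ?_ ?_ hlim
  · filter_upwards [eventually_ge_atTop 1] with n hn
    have := hφ n hn
    positivity
  filter_upwards [hp.def hl₀, eventually_ge_atTop 1, eventually_one_add_mul_le_rpow hG hδ₀ hφO,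
    (Real.tendsto_log_atTop.comp tendsto_natCast_atTop_atTop).eventually_ge_atTop 1] with
    n hpn hn hbase hlog_n
  have hφn := hφ n hn
  have hlog_n : 1 ≤ Real.log n := hlog_n
  rw [Real.norm_of_nonneg (by positivity), Real.norm_of_nonneg n.cast_nonneg] at hpn
  have hexponent : p n * Real.log n + p n * Real.log n * ((δ₀ + 2) / 2) +
      Real.log q * ((n + ν) / 2) ≤ -(-Real.log q / 4 * n) := by
    have hdim := mul_le_mul_of_nonneg_right hpn (show 0 ≤ 1 + (δ₀ + 2) / 2 by positivity)
    rw [mul_right_comm l, hlq] at hdim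
    linarith [mul_nonneg (neg_pos.2 hlog).le hν]
  calc _ ≤ Real.exp (p n * Real.log n) * (C * Real.exp (p n * Real.log n * ((δ₀ + 2) / 2)) *
          Real.exp (Real.log q * ((n + ν) / 2))) := by
        rw [← Real.rpow_def_of_pos hq₀]
        gcongr
        · exact two_pow_le_exp_mul_log hlog_n
        · exact pow_rpow_half_le_exp_mul_log hn (by positivity) hbase
    _ = C * Real.exp (p n * Real.log n + p n * Real.log n * ((δ₀ + 2) / 2) +
          Real.log q * ((n + ν) / 2)) := by
        rw [Real.exp_add, Real.exp_add]
        ring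
    _ ≤ _ := by gcongr

end Rates

theorem one_sub_le_posterior_of_typicalNoise {n p : ℕ} {ν C g G h t T K v a b m : ℝ}
    {prior : PMF (Finset (Fin p))} {c : Fin p → ℝ} {X : Matrix (Fin n) (Fin p) ℝ} {β : Fin p → ℝ}
    {e : Fin n → ℝ} (hn : 1 ≤ n) (hν : 0 < ν) (hνn : ν ≤ a * n) (ht : 0 < t)
    (hc : ∀ j, c j ∈ Set.Icc t T) (hv : 0 < v) (ha : a ∈ Set.Ioo 0 1) (hm : 0 ≤ m)
    (hβ : ∀ j ∈ stateOf β, m ≤ |β j|) (hb : b ≤ min (a / 2 * v) (g * m ^ 2 / 16)) (hg : 0 < g)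
    (hG : 0 ≤ G) (hh : 0 < h) (h₀ : (stateOf β).Nonempty) (hC : 0 ≤ C)
    (hprior₀ : prior (stateOf β) ≠ 0)
    (hprior : ∀ γ, (prior γ).toReal / (prior (stateOf β)).toReal ≤ C)
    (hR : RegularDesign (stateOf β) (n * g) G h X) (hT : TypicalNoise (stateOf β) v a b X e)
    (hK : (2 * ∑ j ∈ stateOf β, β j ^ 2 + 4 * v / g) / t ≤ K) (hKv : 1 + K ≤ v * n)
    (hKm : K ≤ g * m ^ 2 / 8 * n) :
    1 - (C * Real.exp ((1 + a) / (2 * (1 - a) * v) * K) *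
        ((1 + (n : ℝ) ^ ((1 + a) ^ 2 / (1 - a)) * (h * t) ^ (-(1 / 2) : ℝ)) ^ p - 1) +
      2 ^ p * (C * ((1 + G * T) ^ p) ^ (1 / 2 : ℝ) *
        (12 * v / (12 * v + g * m ^ 2)) ^ ((n + ν) / 2))) ≤
      posterior ν prior c X (X *ᵥ β + e) (stateOf β) := by
  have htc (j : Fin p) : t ≤ c j := (hc j).1
  have hcT (j : Fin p) : c j ≤ T := (hc j).2
  have hT₀ : 0 ≤ T := h₀.elim fun j _ => ht.le.trans ((htc j).trans (hcT j))
  have hprior' (γ) : (prior γ).toReal ≤ C * (prior (stateOf β)).toReal :=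
    (div_le_iff₀ (ENNReal.toReal_pos hprior₀ (prior.apply_ne_top _))).1 (hprior γ)
  refine one_sub_le_posterior (fun j => ht.trans_le (htc j)) hprior₀ (by positivity)
    (by positivity) (by positivity) (fun γ hγ => ?_) fun γ hγ => ?_
  · exact postWeight_le_of_mem_S₁ hn hν hνn ht htc hv ha.1 ha.2 (hb.trans (min_le_left _ _)) hg hh
      h₀ hC (hprior' γ) hR hT hK hγ
  · exact postWeight_le_of_mem_S₂ hn hν ht htc hcT hv hm hβ (hb.trans (min_le_right _ _)) hg hG hh
      h₀ (hprior' γ) hR hT hK hKv hKm hγ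

theorem exists_forall_eventually_one_sub_le_posterior {p : ℕ → ℕ} {β : ∀ n, Fin (p n) → ℝ}
    {prior : ∀ n, PMF (Finset (Fin (p n)))} {φlo φhi : ℕ → ℝ} {ν C g G C₃ δ δ₀ v m : ℝ}
    (hν : 0 < ν) (hv : 0 < v) (hg : 0 < g) (hG : 0 ≤ G) (hC₃ : 0 < C₃) (hδ : 0 ≤ δ) (hm : 0 < m)
    (h₀ : ∀ n, 1 ≤ n → (stateOf (β n)).Nonempty)
    (hβ : ∀ n, 1 ≤ n → ∀ j ∈ stateOf (β n), m ≤ |β n j|) (hC : 0 ≤ C)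
    (hprior₀ : ∀ n, 1 ≤ n → prior n (stateOf (β n)) ≠ 0)
    (hprior : ∀ n, 1 ≤ n → ∀ γ, (prior n γ).toReal / (prior n (stateOf (β n))).toReal ≤ C)
    (hp : (fun n : ℕ => (p n : ℝ) * Real.log n) =o[atTop] fun n : ℕ => (n : ℝ))
    (hδ₀ : 3 + δ < δ₀)
    (hk : (fun n : ℕ => ∑ j ∈ stateOf (β n), β n j ^ 2) =O[atTop] fun n : ℕ => (n : ℝ) ^ δ₀)
    (hφlo : ∀ n, 1 ≤ n → 0 < φlo n) (hφ : ∀ n, 1 ≤ n → φlo n ≤ φhi n)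
    (hφhiO : φhi =O[atTop] fun n : ℕ => (n : ℝ) ^ δ₀)
    (hφloO : (fun n : ℕ => (n : ℝ) ^ δ₀) =O[atTop] φlo) :
    ∃ a > 0, ∃ b > 0, ∀ r > 0, ∀ᶠ n : ℕ in atTop,
      ∀ (X : Matrix (Fin n) (Fin (p n)) ℝ) (e : Fin n → ℝ) (c : Fin (p n) → ℝ),
      RegularDesign (stateOf (β n)) (n * g) (n * G) (n * (C₃ * (n : ℝ) ^ (-δ))) X →
      TypicalNoise (stateOf (β n)) v a b X e → (∀ j, c j ∈ Set.Icc (φlo n) (φhi n)) →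
      1 - r ≤ posterior ν (prior n) c X (X *ᵥ β n + e) (stateOf (β n)) := by
  obtain ⟨a, ha, hlt⟩ := exists_mem_Ioo_two_mul_sq_div_lt (r := δ₀ - 1 - δ) (by linarith)
  have ha₀ : 0 < a := ha.1
  have hq : 12 * v / (12 * v + g * m ^ 2) < 1 := by
    rw [div_lt_one (by positivity)]
    linarith [show 0 < g * m ^ 2 by positivity]
  obtain ⟨K, hK⟩ := exists_forall_eventually_div_le (by linarith) hφlo hk hφloO (4 * v / g)
  have hx : ∀ᶠ n : ℕ in atTop, 0 ≤ (n : ℝ) ^ ((1 + a) ^ 2 / (1 - a)) *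
      (n * (C₃ * (n : ℝ) ^ (-δ)) * φlo n) ^ (-(1 / 2) : ℝ) := by
    filter_upwards [eventually_ge_atTop 1] with n hn
    have := hφlo n hn
    positivity
  have hover := tendsto_one_add_pow_sub_one hx
    (tendsto_dim_mul_rpow_mul_rpow_neg_half hp (by linarith) hC₃ hφlo hφloO)
  have hunder := tendsto_two_pow_mul_rpow_mul_rpow hp hν.le hC hG (by positivity) hq
    (by linarith) (fun n hn => (hφlo n hn).trans_le (hφ n hn)) hφhiO
  have hlim := (hover.const_mul (C * Real.exp ((1 + a) / (2 * (1 - a) * v) * K))).add hunder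
  rw [mul_zero, zero_add] at hlim
  refine ⟨a, ha₀, min (a / 2 * v) (g * m ^ 2 / 16), by positivity, fun r hr => ?_⟩
  have hlin {l : ℝ} (hl : 0 < l) (x : ℝ) : ∀ᶠ n : ℕ in atTop, x ≤ l * n :=
    (tendsto_natCast_atTop_atTop.const_mul_atTop hl).eventually_ge_atTop x
  filter_upwards [hlim.eventually_le_const hr, hK, hlin ha₀ ν, hlin hv (1 + K),
    hlin (by positivity : 0 < g * m ^ 2 / 8) K, eventually_ge_atTop 1] with
    n hn_lim hn_K hνn hKv hKm hn X e c hR hT hc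
  have : (0 : ℝ) < n := by exact_mod_cast hn
  exact (sub_le_sub_left hn_lim 1).trans (one_sub_le_posterior_of_typicalNoise hn hν hνn
    (hφlo n hn) hc hv ha hm.le (hβ n hn) le_rfl hg (by positivity) (by positivity) (h₀ n hn) hC
    (hprior₀ n hn) (hprior n hn) hR hT hn_K hKv hKm)

section Consistency

theorem dist_iInf_one_le {ι : Type*} [Nonempty ι] {f : ι → ℝ} {r : ℝ} (hr : ∀ i, 1 - r ≤ f i)
    (hf : ∀ i, f i ≤ 1) : dist (⨅ i, f i) 1 ≤ r := by
  have hlow : 1 - r ≤ ⨅ i, f i := le_ciInf hr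
  have hupp : ⨅ i, f i ≤ 1 :=
    (ciInf_le ⟨1 - r, Set.forall_mem_range.2 hr⟩ (Classical.arbitrary ι)).trans (hf _)
  rw [dist_comm, Real.dist_eq, abs_of_nonneg (sub_nonneg.2 hupp)]
  linarith

variable {Ω : Type*} [MeasurableSpace Ω] {μ : Measure Ω}

theorem tendstoInMeasure_of_tendsto_measure_not {ι E : Type*} [PseudoMetricSpace E] {l : Filter ι}
    {f : ι → Ω → E} {x : Ω → E} {R : ι → Ω → Prop}
    (hR : Tendsto (fun i => μ {ω | ¬ R i ω}) l (𝓝 0))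
    (h : ∀ r > 0, ∀ᶠ i in l, ∀ ω, R i ω → dist (f i ω) (x ω) ≤ r) :
    TendstoInMeasure μ f l x := by
  rw [tendstoInMeasure_iff_dist]
  refine fun r hr => tendsto_of_tendsto_of_tendsto_of_le_of_le' tendsto_const_nhds hR
    (.of_forall fun _ => zero_le) ?_
  filter_upwards [h (r / 2) (half_pos hr)] with i hi
  refine measure_mono fun ω (hω : r ≤ dist (f i ω) (x ω)) hRω => ?_
  linarith [hi ω hRω]

theorem tendsto_measure_not_and {ι : Type*} {l : Filter ι} {R T J : ι → Ω → Prop}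
    (hR : Tendsto (fun i => μ {ω | ¬ R i ω}) l (𝓝 0))
    (hT : Tendsto (fun i => μ {ω | J i ω ∧ ¬ T i ω}) l (𝓝 0))
    (hRJ : ∀ᶠ i in l, ∀ ω, R i ω → J i ω) :
    Tendsto (fun i => μ {ω | ¬ (R i ω ∧ T i ω)}) l (𝓝 0) := by
  have hadd := hR.add hT
  rw [add_zero] at hadd
  refine tendsto_of_tendsto_of_tendsto_of_le_of_le' tendsto_const_nhds hadd
    (.of_forall fun _ => zero_le) ?_
  filter_upwards [hRJ] with i hi
  refine (measure_mono fun ω hω => ?_).trans (measure_union_le _ _)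
  by_cases hRω : R i ω
  · exact .inr ⟨hi ω hRω, fun hTω => hω ⟨hRω, hTω⟩⟩
  · exact .inl hRω

end Consistency

end BayesSel

theorem mainTheorem7
    {Ω : Type*} [MeasurableSpace Ω] (μ : Measure Ω) [IsProbabilityMeasure μ]
    -- dimensions, noise level, degrees of freedom
    (p : ℕ → ℕ) (σ₀ : ℝ≥0) (hσ₀ : 0 < σ₀) (ν : ℝ) (hν : 0 < ν)
    -- true coefficients, random or deterministic designs, Gaussian errors
    (β₀ : ∀ n, Fin (p n) → ℝ)
    (X : ∀ n, Ω → Matrix (Fin n) (Fin (p n)) ℝ)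
    (ε : ∀ n, Ω → Fin n → ℝ)
    (hX : ∀ n, 1 ≤ n → ∀ i j, Measurable fun ω => X n ω i j)
    (hε : ∀ n, 1 ≤ n → HasLaw (ε n) (Measure.pi fun _ : Fin n => gaussianReal 0 (σ₀ ^ 2)) μ)
    (hindep : ∀ n, 1 ≤ n → IndepFun (fun ω i j => X n ω i j) (ε n) μ)
    -- the true model is nonnull
    (hnonnull : ∀ n, 1 ≤ n → (BayesSel.stateOf (β₀ n)).Nonempty)
    -- prior on the models
    (prior : ∀ n, PMF (Finset (Fin (p n)))) (C₀ : ℝ) (hC₀ : 0 < C₀)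
    (hpriorpos : ∀ n, 1 ≤ n → prior n (BayesSel.stateOf (β₀ n)) ≠ 0)
    (hprior : ∀ n, 1 ≤ n → ∀ γ : Finset (Fin (p n)),
      (prior n γ).toReal / (prior n (BayesSel.stateOf (β₀ n))).toReal ≤ C₀)
    -- eigenvalue conditions on the design
    (C₁ C₂ : ℝ) (hC₁ : 0 < C₁) (hC₂ : 0 < C₂)
    (hmin : ∀ᵐ ω ∂μ, (C₁ : EReal) ≤
      liminf (fun n => ((BayesSel.phiMin (BayesSel.stateOf (β₀ n)) (X n ω) : ℝ) : EReal)) atTop)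
    (hmax : ∀ᵐ ω ∂μ,
      limsup (fun n => ((BayesSel.phiMax (BayesSel.stateOf (β₀ n)) (X n ω) : ℝ) : EReal)) atTop
        ≤ (C₂ : EReal))
    (C₃ δ : ℝ) (hC₃ : 0 < C₃) (hδ : 0 ≤ δ)
    (hS₁ : ∀ n, 1 ≤ n → ∀ᵐ ω ∂μ, ∀ γ ∈ BayesSel.S₁ (BayesSel.stateOf (β₀ n)),
      C₃ * (n : ℝ) ^ (-δ) ≤ BayesSel.eigMin
        (BayesSel.residGram (X n ω) (γ \ BayesSel.stateOf (β₀ n)) (BayesSel.stateOf (β₀ n))))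
    -- size of the nonzero coefficients
    (ψ : ℕ → ℝ) (hψ : ∃ m > 0, ∀ n, 1 ≤ n → m ≤ ψ n)
    (hβ₀ : ∀ n, 1 ≤ n → ∀ j ∈ BayesSel.stateOf (β₀ n), ψ n ≤ |β₀ n j|)
    -- growth conditions
    (hp : (fun n : ℕ => (p n : ℝ) * Real.log n) =o[atTop] fun n : ℕ => (n : ℝ))
    (δ₀ : ℝ) (hδ₀ : 3 + δ < δ₀)
    (hk : (fun n : ℕ => ∑ j ∈ BayesSel.stateOf (β₀ n), β₀ n j ^ 2)
      =O[atTop] fun n : ℕ => (n : ℝ) ^ δ₀)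
    (φlo φhi : ℕ → ℝ) (hφlo : ∀ n, 1 ≤ n → 0 < φlo n) (hφ : ∀ n, 1 ≤ n → φlo n ≤ φhi n)
    (hφhiO : φhi =O[atTop] fun n : ℕ => (n : ℝ) ^ δ₀)
    (hφloO : (fun n : ℕ => (n : ℝ) ^ δ₀) =O[atTop] φlo) :
    TendstoInMeasure μ
      (fun n ω => ⨅ c : {c : Fin (p n) → ℝ // ∀ j, c j ∈ Set.Icc (φlo n) (φhi n)},
        BayesSel.posterior ν (prior n) (c : Fin (p n) → ℝ) (X n ω)
          (X n ω *ᵥ β₀ n + ε n ω) (BayesSel.stateOf (β₀ n)))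
      atTop (fun _ => 1) := by
  obtain ⟨m, hm, hmψ⟩ := hψ
  have hv : (0 : ℝ) < (σ₀ : ℝ) ^ 2 := by positivity
  obtain ⟨a, ha, b, hb, hposterior⟩ := BayesSel.exists_forall_eventually_one_sub_le_posterior
    hν hv (half_pos hC₁) (by positivity : 0 ≤ 2 * C₂) hC₃ hδ hm hnonnull
    (fun n hn j hj => (hmψ n hn).trans (hβ₀ n hn j hj)) hC₀.le hpriorpos hprior hp hδ₀ hk hφlo hφ
    hφhiO hφloO
  have hregular := BayesSel.tendsto_measure_not_of_ae_eventually
    (fun n => BayesSel.measurableSet_regularDesign (fun i j => hX n i.pos i j) _ _ _ _)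
    (BayesSel.ae_eventually_regularDesign hnonnull (half_lt_self hC₁)
      (by linarith : C₂ < 2 * C₂) hmin hmax hS₁)
  have htypical := BayesSel.tendsto_measure_injective_and_not_typicalNoise hσ₀ hX hε hindep hp
    (fun n => BayesSel.stateOf (β₀ n)) ha hb
  refine BayesSel.tendstoInMeasure_of_tendsto_measure_not
    (BayesSel.tendsto_measure_not_and hregular htypical ?_) fun r hr => ?_
  · filter_upwards [eventually_ge_atTop 1] with n hn ω hR
    exact hR.mulVec_injective (hnonnull n hn) (by positivity) (by positivity)
  · filter_upwards [hposterior r hr, eventually_ge_atTop 1] with n hn_post hn ω ⟨hR, hT⟩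
    have : Nonempty {c : Fin (p n) → ℝ // ∀ j, c j ∈ Set.Icc (φlo n) (φhi n)} :=
      ⟨⟨fun _ => φlo n, fun _ => ⟨le_rfl, hφ n hn⟩⟩⟩
    exact BayesSel.dist_iInf_one_le (fun c => hn_post _ _ _ hR hT c.2) fun c =>
      BayesSel.posterior_le_one (fun j => (hφlo n hn).trans_le (c.2 j).1) _ _ _ _ _
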